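/- **Setting.** Let $H$ and $E$ be separable real Hilbert spaces and let $V$ be a Banach space that is compactly and densely embedded in $H$. Let $S: H\times E\to V$ be a map, let $(\eta_k)_{k\ge1}$ be i.i.d. random variables in $E$ with law $\ell$, and suppose that the support $\mathcal K:=\operatorname{supp}\ell$ is compact in $E$. For $u\in H$ let $u_0(u)=u$, $u_k(u)=S(u_{k-1}(u),\eta_k)$ for $k\ge1$, and let $P_k(u,\cdot)$ be the law of $u_k(u)$ on $H$, $k\ge0$. Let $B_H(R)$ be the closed ball of radius $R$ in $H$ centred at the origin. For Borel probability measures $\mu,\nu$ on $H$ put $$\|\mu-\nu\|_L^*=\sup\Big\{\Big|\int_H f\,d\mu-\int_H f\,d\nu\Big| : f:H\to\mathbb R,\ \sup_H|f|\le1,\ \operatorname{Lip}(f)\le1\Big\}.$$ **Assumptions.** (A1) $S:H\times E\to V$ is twice continuously differentiable, and its derivatives up to second order are bounded on bounded sets. (H1) There are an orthonormal basis $(e_j)_{j\ge1}$ of $E$, real numbers $b_j\neq0$ with $\sum_j b_j^2<\infty$, and independent real random variables $\xi_{jk}$, $j,k\ge1$, such that almost surely $\eta_k=\sum_{j\ge1}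 b_j\xi_{jk}e_j$ and $|\xi_{jk}|\le1$, and the law of $\xi_{jk}$ is $\rho_j(r)\,dr$ with a Lipschitz density $\rho_j:\mathbb R\to[0,\infty)$ satisfying $\rho_j(0)\ne0$. (H2) There are constants $0<\gamma<1$ and $\beta>0$ such that $\|S(u,\eta)\|_H\le\gamma\|u\|_H+\beta$ and $\|S(u,0)\|_H\le\gamma\|u\|_H$ for all $u\in H$, $\eta\in\mathcal K$. (H3) For all $u\in H$ and $\eta\in\mathcal K$ the image of the operator $D_\eta S(u,\eta):E\to V$ is dense in $H$. **Theorem.** Assume (A1), (H1), (H2) and (H3). Then for every $R_*>0$ there are constants $\kappa\in(0,1)$ and $C>0$ such that for all $u,u'\in B_H(R_*)$ and all integers $k\ge0$, $$\|P_k(u,\cdot)-P_k(u',\cdot)\|_L^*\le C\,\|u-u'\|_H\,\kappa^k .$$ -/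

import Mathlib

open MeasureTheory ProbabilityTheory Set

noncomputable section

namespace RDS

/-- The values `|⟨μ - ν, f⟩|` over all Lipschitz functions `f` on `X` with
`sup |f| ∨ Lip f ≤ 1`. -/
def lipDualSet {X : Type*} [PseudoEMetricSpace X] [MeasurableSpace X] (μ ν : Measure X) : Set ℝ :=
  {r | ∃ f : X → ℝ, (∀ x, |f x| ≤ 1) ∧ LipschitzWith 1 f ∧ r = |∫ x, f x ∂μ - ∫ x, f x ∂ν|}

/-- The Lipschitz-dual distance `‖μ - ν‖_L^*`. -/
def lipDual {X : Type*} [PseudoEMetricSpace X] [MeasurableSpace X] (μ ν : Measure X) : ℝ :=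
  sSup (lipDualSet μ ν)

/-- For probability measures the set under the supremum is bounded, so that `lipDual` is a genuine
supremum. -/
lemma bddAbove_lipDualSet {X : Type*} [PseudoEMetricSpace X] [MeasurableSpace X]
    (μ ν : Measure X) [IsProbabilityMeasure μ] [IsProbabilityMeasure ν] :
    BddAbove (lipDualSet μ ν) := by
  refine ⟨2, ?_⟩
  rintro r ⟨f, hf, -, rfl⟩
  have hμ := norm_integral_le_of_norm_le_const (μ := μ) (f := f) (C := 1)
    (Filter.Eventually.of_forall hf)
  have hν := norm_integral_le_of_norm_le_const (μ := ν) (f := f) (C := 1)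
    (Filter.Eventually.of_forall hf)
  simp only [Real.norm_eq_abs, probReal_univ, mul_one] at hμ hν
  calc |∫ x, f x ∂μ - ∫ x, f x ∂ν| ≤ |∫ x, f x ∂μ| + |∫ x, f x ∂ν| := abs_sub _ _
    _ ≤ 2 := by linarith

lemma lipDualSet_nonempty {X : Type*} [PseudoEMetricSpace X] [MeasurableSpace X]
    (μ ν : Measure X) : (lipDualSet μ ν).Nonempty :=
  ⟨_, fun _ => 0, by simp, LipschitzWith.const' 0, rfl⟩

section System

variable {H E V Ω : Type*}
  [NormedAddCommGroup H] [InnerProductSpace ℝ H]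
  [NormedAddCommGroup E] [InnerProductSpace ℝ E]
  [NormedAddCommGroup V] [NormedSpace ℝ V]

/-- The trajectory `u_0 = v`, `u_k = S (u_{k-1}, η_k)`, seen in `H` through the embedding
`ι : V → H`; the noise sequence is indexed from `0`, so that `η k` drives the step from time `k` to
time `k + 1`. -/
def traj (ι : V →L[ℝ] H) (S : H × E → V) (η : ℕ → Ω → E) (v : H) : ℕ → Ω → H
  | 0, _ => v
  | k + 1, ω => ι (S (traj ι S η v k ω, η k ω))

/-- The transition probability after `k` steps: `P_k(u, Γ) = Prob (u_k(u) ∈ Γ)`. -/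
def transProb [MeasurableSpace H] [MeasurableSpace Ω] (P : Measure Ω)
    (ι : V →L[ℝ] H) (S : H × E → V) (η : ℕ → Ω → E) (k : ℕ) (u : H) : Measure H :=
  P.map (traj ι S η u k)

/-- Regularity: `S` is twice continuously differentiable and its derivatives up to second order are
bounded on bounded sets. -/
def Regularity (S : H × E → V) : Prop :=
  ContDiff ℝ 2 S ∧
    ∀ B : Set (H × E), Bornology.IsBounded B →
      ∃ C : ℝ, ∀ p ∈ B, ∀ i : ℕ, i ≤ 2 → ‖iteratedFDeriv ℝ i S p‖ ≤ C

/-- Decomposability and non-degeneracy of the noise: `η_k = ∑_j b_j ξ_{jk} e_j` almost surely, with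
an orthonormal basis `e`, nonzero square-summable `b`, and independent `ξ_{jk}` bounded by `1`
whose law has a Lipschitz density `ρ_j` with `ρ_j(0) ≠ 0`. -/
def DecomposableNoise [MeasurableSpace Ω] (P : Measure Ω) (η : ℕ → Ω → E) : Prop :=
  ∃ (e : HilbertBasis ℕ ℝ E) (b : ℕ → ℝ) (ξ : ℕ × ℕ → Ω → ℝ) (ρ : ℕ → ℝ → ℝ),
    (∀ j, b j ≠ 0) ∧
    Summable (fun j => b j ^ 2) ∧
    (∀ i, Measurable (ξ i)) ∧
    iIndepFun ξ P ∧
    (∀ i, ∀ᵐ ω ∂P, |ξ i ω| ≤ 1) ∧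
    (∀ j, (∀ r, 0 ≤ ρ j r) ∧ (∃ L, LipschitzWith L (ρ j)) ∧ ρ j 0 ≠ 0) ∧
    (∀ j k, P.map (ξ (j, k)) = volume.withDensity (fun r => ENNReal.ofReal (ρ j r))) ∧
    (∀ k, ∀ᵐ ω ∂P, HasSum (fun j => (b j * ξ (j, k) ω) • e j) (η k ω))

/-- Dissipativity, with `K` the support of the law of the noise. -/
def Dissipative (ι : V →L[ℝ] H) (S : H × E → V) (K : Set E) : Prop :=
  ∃ γ β : ℝ, 0 < γ ∧ γ < 1 ∧ 0 < β ∧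
    ∀ u : H, (∀ ζ ∈ K, ‖ι (S (u, ζ))‖ ≤ γ * ‖u‖ + β) ∧ ‖ι (S (u, 0))‖ ≤ γ * ‖u‖

/-- Non-degeneracy: for `u ∈ H` and `ζ ∈ K` the image of the partial derivative
`D_η S(u, ζ) : E → V` is dense in `H`. -/
def Nondegenerate (ι : V →L[ℝ] H) (S : H × E → V) (K : Set E) : Prop :=
  ∀ u : H, ∀ ζ ∈ K, DenseRange (fun h : E => ι (fderiv ℝ (fun ζ' : E => S (u, ζ')) ζ h))

end System

end RDS

end

/-! Write `F = ι ∘ S` and let `T` be the Markov operator `f ↦ (u ↦ E f (F (u, η)))`. The proof is a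
duality argument: on a compact invariant set `X`, some power of `T` contracts the Lipschitz seminorm
for the truncated metric `min 1 (‖x - y‖ / δ)`.

Nearby points are handled by smoothing (`exists_gradient_bound`): `|T g u - T g u'| ≤ (C sup |g| + ε
Lip g) ‖u' - u‖`, with `ε` as small as desired. The derivative of `F` in `u` is compact and its
derivative in the noise has dense range, so a unit displacement `v` of the state can be cancelled up
to `ε` by a displacement `h` of the noise along finitely many basis vectors (`exists_controls`).
Thus `F (u', η + s h)` is within `s ε` of `F (u, η)`, where `s = ‖u' - u‖`; removing the shift `s h`
costs `O(s)` times `sup |g|`, because the coordinates of the noise are independent with Lipschitz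
densities. As `h` depends on `η`, the noise is cut into finitely many cells on each of which a
single `h` works.

If `f` has seminorm `c`, its oscillation on `X` is at most `c`; so after subtracting a constant the
estimate applies with `sup |g| ≤ c` and `Lip g ≤ c / δ`. For small `δ` and `ε = 1/4` the local slope
is halved.

Distant points are handled by running both copies with the same noise
(`exists_observable_contraction`): small noise has positive probability, and under it dissipativity
brings both copies close to the origin, hence to each other. This lowers the oscillation by a fixed
factor. Iteration gives a geometric rate on `X`; arbitrary initial points enter `X` after one step,
which is Lipschitz in the initial point. -/

namespace RDS

/-! ### Translating a Lipschitz density cut off to an interval -/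

/-- A constant `C` controls the `L¹`-cost of translating the restriction of `ν` to `I`. -/
def ShiftBound (ν : Measure ℝ) (I : Set ℝ) (C : ℝ) : Prop :=
  ∀ (t B : ℝ) (g : ℝ → ℝ), Measurable g → (∀ s, |g s| ≤ B) →
    |∫ s in I, g (s + t) ∂ν - ∫ s in I, g s ∂ν| ≤ C * |t| * B

/-- If `s` and `s - t` both lie in the interval, the Lipschitz bound applies. If only one does, an
endpoint separates them, so `s` is within `|t|` of that endpoint, where the jump of the truncated
density costs at most `Q`. -/
lemma abs_indicator_sub_le {ρ : ℝ → ℝ} {L : NNReal} (hL : LipschitzWith L ρ) {a b Q : ℝ}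
    (hQ0 : 0 ≤ Q) (hQ : ∀ s ∈ Ico a b, |ρ s| ≤ Q) (s t : ℝ) :
    |(Ico a b).indicator ρ (s - t) - (Ico a b).indicator ρ s| ≤
      (Ico a b).indicator (fun _ => L * |t|) s +
        ((Icc (a - |t|) (a + |t|)).indicator (fun _ => Q) s +
          (Icc (b - |t|) (b + |t|)).indicator (fun _ => Q) s) := by
  have h1 : 0 ≤ (Icc (a - |t|) (a + |t|)).indicator (fun _ => Q) s :=
    indicator_nonneg (fun _ _ => hQ0) _
  have h2 : 0 ≤ (Icc (b - |t|) (b + |t|)).indicator (fun _ => Q) s :=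
    indicator_nonneg (fun _ _ => hQ0) _
  have h3 : 0 ≤ (Ico a b).indicator (fun _ => (L : ℝ) * |t|) s :=
    indicator_nonneg (fun _ _ => by positivity) _
  have ht := neg_abs_le t
  have ht' := le_abs_self t
  have key : ∀ {x y : ℝ}, x ∈ Ico a b → y ∉ Ico a b → |x - y| ≤ |t| → |s - x| ≤ |t| →
      |s - y| ≤ |t| → s ∈ Icc (a - |t|) (a + |t|) ∨ s ∈ Icc (b - |t|) (b + |t|) := by
    intro x y hx hy hxy hsx hsy
    simp only [mem_Ico, not_and_or, not_le, not_lt, mem_Icc] at hx hy ⊢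
    rw [abs_le] at hxy hsx hsy
    rcases hy with hy | hy
    · left; constructor <;> linarith
    · right; constructor <;> linarith
  have e1 : |s - (s - t)| ≤ |t| := by rw [sub_sub_cancel]
  have e2 : |s - s| ≤ |t| := by simp
  have e3 : |s - t - s| ≤ |t| := by rw [abs_sub_comm]; exact e1
  by_cases hs : s ∈ Ico a b <;> by_cases hst : s - t ∈ Ico a b
  · have : |ρ (s - t) - ρ s| ≤ L * |t| := by
      have := hL.dist_le_mul (s - t) s
      simpa [Real.dist_eq] using this
    rw [indicator_of_mem hs, indicator_of_mem hst, indicator_of_mem hs]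
    linarith
  · rw [indicator_of_mem hs, indicator_of_notMem hst, zero_sub, abs_neg]
    have := hQ s hs
    rcases key hs hst e1 e2 e1 with h | h
    · rw [indicator_of_mem h] at h1 ⊢; linarith
    · rw [indicator_of_mem h] at h2 ⊢; linarith
  · rw [indicator_of_notMem hs, indicator_of_mem hst, sub_zero]
    have := hQ _ hst
    rcases key hst hs e3 e1 e2 with h | h
    · rw [indicator_of_mem h] at h1 ⊢; linarith
    · rw [indicator_of_mem h] at h2 ⊢; linarith
  · rw [indicator_of_notMem hs, indicator_of_notMem hst, sub_zero, abs_zero]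
    linarith

lemma exists_shiftBound {ρ : ℝ → ℝ} (hρ : ∀ r, 0 ≤ ρ r) {L : NNReal} (hL : LipschitzWith L ρ)
    (a b : ℝ) :
    ∃ C, 0 ≤ C ∧
      ShiftBound (volume.withDensity (fun r => ENNReal.ofReal (ρ r))) (Ico a b) C := by
  obtain ⟨Q, hQ⟩ := isCompact_Icc.exists_bound_of_continuousOn
    (s := Icc a b) (f := ρ) hL.continuous.continuousOn
  have hQ' : ∀ s ∈ Ico a b, |ρ s| ≤ |Q| := fun s hs =>
    (hQ s (Ico_subset_Icc_self hs)).trans (le_abs_self Q)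
  -- Each of the two endpoint windows has length `2 * |t|` and height `|Q|`, whence the `4`.
  refine ⟨L * |b - a| + |Q| * 4, by positivity, fun t B g hg hB => ?_⟩
  have hB0 : 0 ≤ B := (abs_nonneg _).trans (hB 0)
  set w := (Ico a b).indicator ρ with hw
  have hwi : Integrable w := by
    rw [hw, integrable_indicator_iff measurableSet_Ico]
    exact (hL.continuous.continuousOn.integrableOn_Icc).mono_set Ico_subset_Icc_self
  have conv : ∀ f : ℝ → ℝ, ∫ s in Ico a b, f s ∂(volume.withDensity
      (fun r => ENNReal.ofReal (ρ r))) = ∫ s, w s * f s := by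
    intro f
    rw [setIntegral_withDensity_eq_setIntegral_toReal_smul
      hL.continuous.measurable.ennreal_ofReal (by simp) _ measurableSet_Ico,
      ← integral_indicator measurableSet_Ico]
    congr 1
    ext s
    by_cases hs : s ∈ Ico a b
    · simp [hw, hs, ENNReal.toReal_ofReal (hρ s)]
    · simp [hw, hs]
  have hint : Integrable (fun s => w s * g s) :=
    hwi.mul_bdd hg.aestronglyMeasurable (Filter.Eventually.of_forall hB)
  have hint' : Integrable (fun s => w (s - t) * g s) :=
    (hwi.comp_sub_right t).mul_bdd hg.aestronglyMeasurable (Filter.Eventually.of_forall hB)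
  have hshift : ∫ s, w s * g (s + t) = ∫ s, w (s - t) * g s := by
    rw [← integral_sub_right_eq_self (fun s => w s * g (s + t)) t]
    simp
  have i1 : Integrable ((Ico a b).indicator (fun _ => (L : ℝ) * |t|)) := by
    rw [integrable_indicator_iff measurableSet_Ico]
    exact integrableOn_const (by simp)
  have i2 : ∀ c : ℝ, Integrable ((Icc (c - |t|) (c + |t|)).indicator (fun _ => |Q|)) := by
    intro c
    rw [integrable_indicator_iff measurableSet_Icc]
    exact integrableOn_const (by simp)
  have v1 : ∫ s, (Ico a b).indicator (fun _ => (L : ℝ) * |t|) s ≤ L * |t| * |b - a| := by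
    rw [integral_indicator measurableSet_Ico, setIntegral_const, smul_eq_mul, mul_comm]
    refine mul_le_mul_of_nonneg_left ?_ (by positivity)
    rw [measureReal_def, Real.volume_Ico, ENNReal.toReal_ofReal']
    exact max_le (le_abs_self _) (abs_nonneg _)
  have v2 : ∀ c : ℝ, ∫ s, (Icc (c - |t|) (c + |t|)).indicator (fun _ => |Q|) s = 2 * |t| * |Q| := by
    intro c
    rw [integral_indicator measurableSet_Icc, setIntegral_const, smul_eq_mul, measureReal_def,
      Real.volume_Icc, ENNReal.toReal_ofReal (by linarith [abs_nonneg t])]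
    ring
  rw [conv, conv, hshift, ← integral_sub hint' hint]
  calc |∫ s, (w (s - t) * g s - w s * g s)|
      ≤ ∫ s, ((Ico a b).indicator (fun _ => (L : ℝ) * |t|) s +
        ((Icc (a - |t|) (a + |t|)).indicator (fun _ => |Q|) s +
          (Icc (b - |t|) (b + |t|)).indicator (fun _ => |Q|) s)) * B := by
        rw [← Real.norm_eq_abs]
        refine norm_integral_le_of_norm_le ((i1.add ((i2 a).add (i2 b))).mul_const B)
          (Filter.Eventually.of_forall fun s => ?_)
        rw [← sub_mul, norm_mul]
        exact mul_le_mul (abs_indicator_sub_le hL (abs_nonneg Q) hQ' s t) (hB s)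
          (norm_nonneg _) ((abs_nonneg _).trans (abs_indicator_sub_le hL (abs_nonneg Q) hQ' s t))
    _ ≤ (L * |b - a| + |Q| * 4) * |t| * B := by
        have i3 : Integrable fun s => (Icc (a - |t|) (a + |t|)).indicator (fun _ => |Q|) s +
          (Icc (b - |t|) (b + |t|)).indicator (fun _ => |Q|) s := (i2 a).add (i2 b)
        rw [integral_mul_const, integral_add i1 i3, integral_add (i2 a) (i2 b), v2, v2]
        refine mul_le_mul_of_nonneg_right ?_ hB0
        linarith

/-! ### Shifting finitely many coordinates of the noise -/

section Coordinates

variable {Ω : Type*} [MeasurableSpace Ω] {P : Measure Ω}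

/-- By Fubini, `Y` can be frozen; the one-dimensional bound then applies to each section of `g`. -/
lemma abs_integral_shift_le_of_indepFun [IsProbabilityMeasure P] {𝓨 : Type*} [MeasurableSpace 𝓨] {X : Ω → ℝ} {Y : Ω → 𝓨}
    (hX : Measurable X) (hY : Measurable Y) (hXY : IndepFun X Y P) {I : Set ℝ}
    (hI : MeasurableSet I) {C : ℝ} (hC : ShiftBound (P.map X) I C) {B : ℝ}
    {g : ℝ × 𝓨 → ℝ} (hg : Measurable g) (hB : ∀ p, |g p| ≤ B) (t : ℝ) :
    |∫ ω, I.indicator 1 (X ω) * (g (X ω + t, Y ω) - g (X ω, Y ω)) ∂P| ≤ C * |t| * B := by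
  have hprod := (indepFun_iff_map_prod_eq_prod_map_map hX.aemeasurable hY.aemeasurable).1 hXY
  have : IsProbabilityMeasure (P.map X) := Measure.isProbabilityMeasure_map hX.aemeasurable
  have : IsProbabilityMeasure (P.map Y) := Measure.isProbabilityMeasure_map hY.aemeasurable
  have hB0 : 0 ≤ B := by
    obtain ⟨ω⟩ := P.nonempty_of_neZero
    exact (abs_nonneg _).trans (hB (X ω, Y ω))
  set h : ℝ × 𝓨 → ℝ := fun p => I.indicator 1 p.1 * (g (p.1 + t, p.2) - g p) with hh
  have hind : Measurable (I.indicator (1 : ℝ → ℝ)) := measurable_one.indicator hI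
  have hmeas : Measurable h := by fun_prop
  have hle : ∀ p, ‖h p‖ ≤ 2 * B := by
    intro p
    rw [hh, norm_mul]
    have h1 : ‖I.indicator (1 : ℝ → ℝ) p.1‖ ≤ 1 := by
      by_cases hp : p.1 ∈ I <;> simp [hp]
    have h2 : ‖g (p.1 + t, p.2) - g p‖ ≤ 2 * B := by
      refine (norm_sub_le _ _).trans ?_
      have := hB (p.1 + t, p.2)
      have := hB p
      simp only [Real.norm_eq_abs]; linarith
    calc _ ≤ 1 * (2 * B) := mul_le_mul h1 h2 (norm_nonneg _) zero_le_one
      _ = _ := one_mul _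
  have hint : Integrable h ((P.map X).prod (P.map Y)) :=
    .of_bound hmeas.aestronglyMeasurable (2 * B) (Filter.Eventually.of_forall hle)
  have e : ∫ ω, I.indicator 1 (X ω) * (g (X ω + t, Y ω) - g (X ω, Y ω)) ∂P =
      ∫ y, ∫ x, h (x, y) ∂(P.map X) ∂(P.map Y) := by
    rw [← integral_prod_symm _ hint, ← hprod, integral_map (by fun_prop)
      hmeas.aestronglyMeasurable]
  rw [e, ← Real.norm_eq_abs]
  refine (norm_integral_le_of_norm_le_const (C := C * |t| * B)
    (Filter.Eventually.of_forall fun y => ?_)).trans_eq (by simp)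
  have bi : ∀ c : ℝ, Integrable (fun x => g (x + c, y)) ((P.map X).restrict I) := fun c =>
    Integrable.of_bound (hg.comp (by fun_prop)).aestronglyMeasurable B
      (Filter.Eventually.of_forall fun x => hB _)
  have e2 : ∫ x, h (x, y) ∂(P.map X) =
      ∫ x in I, g (x + t, y) ∂(P.map X) - ∫ x in I, g (x, y) ∂(P.map X) := by
    rw [← integral_sub (bi t) (by simpa using bi 0), ← integral_indicator hI]
    congr 1
    ext x
    by_cases hx : x ∈ I <;> simp [hh, hx]
  rw [e2]
  exact hC t B (fun x => g (x, y)) (by fun_prop) (fun x => hB _)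

lemma indepFun_update {ξ : ℕ → Ω → ℝ} (hξ : ∀ i, Measurable (ξ i)) (hind : iIndepFun ξ P) (m : ℕ) :
    IndepFun (ξ m) (fun ω => Function.update (fun i => ξ i ω) m 0) P := by
  have h := indep_iSup_of_disjoint (m := fun i => MeasurableSpace.comap (ξ i) inferInstance)
    (fun i => (hξ i).comap_le) hind (S := {m}) (T := {m}ᶜ) disjoint_compl_right
  rw [IndepFun_iff_Indep]
  refine indep_of_indep_of_le_left (indep_of_indep_of_le_right h ?_) ?_
  · refine Measurable.comap_le ?_
    rw [@measurable_pi_iff]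
    intro i
    by_cases hi : i = m
    · subst hi; simp
    · simp only [Function.update_of_ne hi]
      have : MeasurableSpace.comap (ξ i) inferInstance ≤
          ⨆ i ∈ ({m}ᶜ : Set ℕ), MeasurableSpace.comap (ξ i) inferInstance :=
        le_iSup₂ (f := fun i (_ : i ∈ ({m}ᶜ : Set ℕ)) => MeasurableSpace.comap (ξ i) inferInstance)
          i hi
      exact (comap_measurable (ξ i)).mono this le_rfl
  · simp

variable {E : Type*} [NormedAddCommGroup E] [NormedSpace ℝ E] [CompleteSpace E]
  [SecondCountableTopology E] [MeasurableSpace E] [BorelSpace E]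

/-- A random series minus its `m`-th term is a measurable function of the other coefficients. -/
lemma exists_measurable_update_eq {ξ : ℕ → Ω → ℝ} (hξ : ∀ i, Measurable (ξ i)) {c : ℕ → E}
    {η : Ω → E} (hη : ∀ᵐ ω ∂P, HasSum (fun j => ξ j ω • c j) (η ω)) (m : ℕ) :
    ∃ Θ : (ℕ → ℝ) → E, Measurable Θ ∧
      ∀ᵐ ω ∂P, Θ (Function.update (fun i => ξ i ω) m 0) = η ω - ξ m ω • c m := by
  set U : Ω → ℕ → ℝ := fun ω => Function.update (fun i => ξ i ω) m 0 with hU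
  have hUm : Measurable U := by
    rw [measurable_pi_iff]
    intro i
    by_cases hi : i = m
    · subst hi; simp [hU]
    · simpa only [hU, Function.update_of_ne hi] using hξ i
  set s : ℕ → (ℕ → ℝ) → E := fun n x => ∑ j ∈ Finset.range n, x j • c j with hs
  have hsm : ∀ n, Measurable (s n) := fun n => by fun_prop
  have hconv : ∀ᵐ ω ∂P, Filter.Tendsto (fun n => s n (U ω)) Filter.atTop
      (nhds (η ω - ξ m ω • c m)) := by
    filter_upwards [hη] with ω hω
    have h1 : HasSum (fun j => if j = m then ξ m ω • c m else 0) (ξ m ω • c m) :=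
      hasSum_ite_eq m _
    refine ((hω.sub h1).tendsto_sum_nat).congr fun n => ?_
    refine Finset.sum_congr rfl fun j _ => ?_
    by_cases hj : j = m
    · subst hj; simp [hU]
    · simp [hU, hj]
  have hset : MeasurableSet {x | ∃ l, Filter.Tendsto (fun n => s n x) Filter.atTop (nhds l)} :=
    measurableSet_exists_tendsto hsm
  obtain ⟨Θ, hΘ, hΘl⟩ := measurable_limit_of_tendsto_metrizable_ae (μ := P.map U)
    (L := Filter.atTop) (f := s) (fun n => (hsm n).aemeasurable)
    ((ae_map_iff hUm.aemeasurable hset).2 (hconv.mono fun ω h => ⟨_, h⟩))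
  refine ⟨Θ, hΘ, ?_⟩
  filter_upwards [ae_of_ae_map hUm.aemeasurable hΘl, hconv] with ω h1 h2
  exact tendsto_nhds_unique h1 h2

/-- The cost of shifting the noise in the first `n` directions, on a product cell. -/
lemma abs_integral_cell_shift_le [IsProbabilityMeasure P] {ξ : ℕ → Ω → ℝ}
    (hξ : ∀ i, Measurable (ξ i))
    (hind : iIndepFun ξ P) {c : ℕ → E} {η : Ω → E} (hηm : Measurable η)
    (hη : ∀ᵐ ω ∂P, HasSum (fun j => ξ j ω • c j) (η ω)) {I : ℕ → Set ℝ}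
    (hI : ∀ j, MeasurableSet (I j)) {C : ℕ → ℝ}
    (hC : ∀ j, ShiftBound (P.map (ξ j)) (I j) (C j)) {G : E → ℝ} (hG : Measurable G) {B : ℝ}
    (hB : ∀ x, |G x| ≤ B) (t : ℕ → ℝ) (M n : ℕ) (hn : n ≤ M) :
    |∫ ω, (∏ j ∈ Finset.range M, (I j).indicator (1 : ℝ → ℝ) (ξ j ω)) *
      (G (η ω + ∑ j ∈ Finset.range n, t j • c j) - G (η ω)) ∂P| ≤
      (∑ j ∈ Finset.range n, C j * |t j|) * B := by
  have hIm : ∀ j, Measurable ((I j).indicator (1 : ℝ → ℝ)) := fun j =>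
    measurable_one.indicator (hI j)
  have hI1 : ∀ j x, ‖(I j).indicator (1 : ℝ → ℝ) x‖ ≤ 1 := by
    intro j x
    by_cases hx : x ∈ I j <;> simp [hx]
  have hprod : ∀ (s : Finset ℕ) (x : ℕ → ℝ), ‖∏ j ∈ s, (I j).indicator (1 : ℝ → ℝ) (x j)‖ ≤ 1 := by
    intro s x
    rw [norm_prod]
    exact Finset.prod_le_one (fun _ _ => norm_nonneg _) (fun j _ => hI1 j _)
  have hint : ∀ h h' : E, Integrable (fun ω =>
      (∏ j ∈ Finset.range M, (I j).indicator (1 : ℝ → ℝ) (ξ j ω)) *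
        (G (η ω + h) - G (η ω + h'))) P := by
    intro h h'
    refine Integrable.of_bound (C := 1 * (B + B)) (by fun_prop)
      (Filter.Eventually.of_forall fun ω => ?_)
    rw [norm_mul]
    refine mul_le_mul (hprod _ (fun j => ξ j ω)) ((norm_sub_le _ _).trans
      (add_le_add (hB _) (hB _))) (norm_nonneg _) zero_le_one
  induction n with
  | zero => simp
  | succ m ih =>
    specialize ih (by omega)
    obtain ⟨Θ, hΘ, hΘe⟩ := exists_measurable_update_eq (P := P) hξ hη m
    set h := ∑ j ∈ Finset.range m, t j • c j with hh
    -- One coordinate is shifted at a time. The other cell indicators and the shifts already made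
    -- are absorbed into a function of `ξ m` and of the independent remaining coefficients, so only
    -- the indicator of `I m` stays as a weight.
    set g : ℝ × (ℕ → ℝ) → ℝ := fun p =>
      (∏ j ∈ (Finset.range M).erase m, (I j).indicator (1 : ℝ → ℝ) (p.2 j)) *
        G (Θ p.2 + p.1 • c m + h) with hg
    have hgm : Measurable g := by fun_prop
    have hgB : ∀ p, |g p| ≤ B := by
      intro p
      rw [hg, abs_mul, ← one_mul B]
      exact mul_le_mul (hprod _ p.2) (hB _) (abs_nonneg _) zero_le_one
    have hUm : Measurable (fun ω => Function.update (fun i => ξ i ω) m 0) := by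
      rw [measurable_pi_iff]
      intro i
      by_cases hi : i = m
      · subst hi; simp
      · simpa only [Function.update_of_ne hi] using hξ i
    have key := abs_integral_shift_le_of_indepFun (hξ m) hUm (indepFun_update hξ hind m) (hI m)
      (hC m) hgm hgB (t m)
    have e1 : ∫ ω, (I m).indicator 1 (ξ m ω) *
        (g (ξ m ω + t m, Function.update (fun i => ξ i ω) m 0) -
          g (ξ m ω, Function.update (fun i => ξ i ω) m 0)) ∂P =
        ∫ ω, (∏ j ∈ Finset.range M, (I j).indicator (1 : ℝ → ℝ) (ξ j ω)) *
          (G (η ω + (h + t m • c m)) - G (η ω + h)) ∂P := by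
      refine integral_congr_ae ?_
      filter_upwards [hΘe] with ω hω
      have hp : ∏ j ∈ (Finset.range M).erase m,
          (I j).indicator (1 : ℝ → ℝ) (Function.update (fun i => ξ i ω) m 0 j) =
          ∏ j ∈ (Finset.range M).erase m, (I j).indicator (1 : ℝ → ℝ) (ξ j ω) :=
        Finset.prod_congr rfl fun j hj => by rw [Function.update_of_ne (Finset.ne_of_mem_erase hj)]
      have a1 : η ω - ξ m ω • c m + (ξ m ω + t m) • c m + h = η ω + (h + t m • c m) := by
        rw [add_smul]; abel
      have a2 : η ω - ξ m ω • c m + ξ m ω • c m + h = η ω + h := by abel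
      simp only [hg, hω, hp, a1, a2]
      rw [← Finset.mul_prod_erase (Finset.range M) _ (Finset.mem_range.2 (by omega : m < M))]
      ring
    rw [e1] at key
    have e2 : ∫ ω, (∏ j ∈ Finset.range M, (I j).indicator (1 : ℝ → ℝ) (ξ j ω)) *
        (G (η ω + ∑ j ∈ Finset.range (m + 1), t j • c j) - G (η ω)) ∂P =
        ∫ ω, (∏ j ∈ Finset.range M, (I j).indicator (1 : ℝ → ℝ) (ξ j ω)) *
          (G (η ω + (h + t m • c m)) - G (η ω + h)) ∂P +
        ∫ ω, (∏ j ∈ Finset.range M, (I j).indicator (1 : ℝ → ℝ) (ξ j ω)) *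
          (G (η ω + h) - G (η ω)) ∂P := by
      have h0 := hint h 0
      simp only [add_zero] at h0
      rw [← integral_add (hint _ _) h0]
      congr 1
      ext ω
      rw [Finset.sum_range_succ]
      ring
    rw [e2, Finset.sum_range_succ, add_mul, add_comm]
    exact (abs_add_le _ _).trans (add_le_add ih key) |>.trans_eq' (by rw [add_comm])

end Coordinates

/-! ### Finite-dimensional approximate controls -/

section Control

variable {H E : Type*} [NormedAddCommGroup H] [NormedSpace ℝ H]
  [NormedAddCommGroup E] [NormedSpace ℝ E]

/-- `M`, `A` and `r` describe finite-dimensional approximate controls on the set `Z`: each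
direction `v` is compensated up to `ε`, locally uniformly, by a combination of the first `M` vectors
`c j` with coefficients bounded by `A`. -/
def Controls (F : H × E → H) (c : ℕ → E) (ε : ℝ) (Z : Set (H × E)) (M : ℕ) (A r : ℝ) : Prop :=
  ∀ p ∈ Z, ∀ v : H, ‖v‖ ≤ 1 → ∃ t : ℕ → ℝ, (∀ j, |t j| ≤ A) ∧ (∀ j, M ≤ j → t j = 0) ∧
    ∀ q, dist q p < r → ‖fderiv ℝ F q (v, ∑ j ∈ Finset.range M, t j • c j)‖ ≤ ε

lemma Controls.mono {F : H × E → H} {c : ℕ → E} {ε : ℝ} {Z Z' : Set (H × E)} {M M' : ℕ}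
    {A A' r r' : ℝ} (h : Controls F c ε Z M A r) (hZ : Z' ⊆ Z) (hM : M ≤ M') (hA : A ≤ A')
    (hr : r' ≤ r) : Controls F c ε Z' M' A' r' := by
  intro p hp v hv
  obtain ⟨t, h1, h2, h3⟩ := h p (hZ hp) v hv
  refine ⟨t, fun j => (h1 j).trans hA, fun j hj => h2 j (hM.trans hj), fun q hq => ?_⟩
  have : ∑ j ∈ Finset.range M', t j • c j = ∑ j ∈ Finset.range M, t j • c j := by
    symm
    refine Finset.sum_subset (Finset.range_mono hM) fun j _ hj => ?_
    rw [h2 j (by simpa using hj), zero_smul]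
  rw [this]
  exact h3 q (hq.trans_le hr)

/-- The image of the unit ball under the compact partial derivative has a finite `ε / 4`-net.
Density of the range and of the span of `c` gives a finite combination cancelling each net point up
to `ε / 4`. Only finitely many controls occur, so `M` and `A` are uniform, and continuity of the
derivative spreads the estimate to a neighbourhood at the cost of a third `ε / 4`. -/
lemma exists_controls_nhds {F : H × E → H} (hF : ContDiff ℝ 1 F) {p : H × E}
    (hcomp : IsCompactOperator (fun v : H => fderiv ℝ F p (v, 0)))
    (hdense : DenseRange (fun h : E => fderiv ℝ F p (0, h))) {c : ℕ → E}
    (hc : Dense (Submodule.span ℝ (range c) : Set E)) {ε : ℝ} (hε : 0 < ε) :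
    ∃ (M : ℕ) (A r : ℝ), 0 < r ∧ Controls F c ε (Metric.ball p r) M A r := by
  set T : H →L[ℝ] H := (fderiv ℝ F p).comp (ContinuousLinearMap.inl ℝ H E) with hT
  have hTc : IsCompact (closure (T '' Metric.closedBall 0 1)) := by
    have : IsCompactOperator T := hcomp
    exact this.isCompact_closure_image_closedBall (f := (T : H →ₗ[ℝ] H)) 1
  obtain ⟨W, hWfin, hW⟩ := Metric.totallyBounded_iff.1
    (hTc.totallyBounded.subset subset_closure) (ε / 4) (by positivity)
  have hctrl : ∀ w : H, ∃ t : ℕ →₀ ℝ,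
      ‖w + fderiv ℝ F p (0, t.sum fun j a => a • c j)‖ < ε / 4 := by
    intro w
    have hd := hdense.dense_image (by fun_prop) hc
    obtain ⟨_, hlt, h, hh, rfl⟩ := Metric.dense_iff.1 hd (-w) (ε / 4) (by positivity)
    obtain ⟨t, rfl⟩ := Finsupp.mem_span_range_iff_exists_finsupp.1 hh
    refine ⟨t, ?_⟩
    rw [Metric.mem_ball, dist_eq_norm, sub_neg_eq_add, add_comm] at hlt
    exact hlt
  choose t ht using hctrl
  set W' := hWfin.toFinset with hW'
  obtain ⟨M, hM⟩ := (W'.image fun w => (t w).support.sup id + 1).exists_le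
  obtain ⟨A, hA⟩ := (W'.image fun w => ∑ j ∈ (t w).support, |t w j|).exists_le
  obtain ⟨J, hJ⟩ := (W'.image fun w => ‖(t w).sum fun j a => a • c j‖).exists_le
  have hJ1 : 0 < max J 1 := by positivity
  have hcont : ContinuousAt (fderiv ℝ F) p := (hF.continuous_fderiv one_ne_zero).continuousAt
  obtain ⟨r, hr, hrc⟩ := Metric.continuousAt_iff.1 hcont (ε / (4 * max J 1)) (by positivity)
  -- Half of the continuity radius is for the base point `p'`, the other half for `q`.
  refine ⟨M, A, r / 2, by positivity, ?_⟩
  intro p' hp' v hv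
  obtain ⟨w, hw, hvw⟩ := mem_iUnion₂.1 (hW ⟨v, by simpa using hv, rfl⟩)
  have hwW : w ∈ W' := hWfin.mem_toFinset.2 hw
  have hMw := hM _ (Finset.mem_image_of_mem _ hwW)
  have hAw := hA _ (Finset.mem_image_of_mem _ hwW)
  have hJw := hJ _ (Finset.mem_image_of_mem _ hwW)
  have hsupp : ∀ j, M ≤ j → t w j = 0 := by
    intro j hj
    by_contra hne
    have : j ≤ (t w).support.sup id := Finset.le_sup (f := id) (Finsupp.mem_support_iff.2 hne)
    omega
  have hsum : ∑ j ∈ Finset.range M, t w j • c j = (t w).sum fun j a => a • c j := by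
    symm
    refine Finset.sum_subset (fun j hj => ?_) fun j _ hj => ?_
    · by_contra hne
      exact Finsupp.mem_support_iff.1 hj (hsupp j (by simpa using hne))
    · simp [Finsupp.notMem_support_iff.1 hj]
  refine ⟨t w, fun j => ?_, hsupp, fun q hq => ?_⟩
  · by_cases hj : j ∈ (t w).support
    · exact (Finset.single_le_sum (f := fun j => |t w j|) (fun _ _ => abs_nonneg _) hj).trans hAw
    · rw [Finsupp.notMem_support_iff.1 hj, abs_zero]
      exact (Finset.sum_nonneg fun _ _ => abs_nonneg _).trans hAw
  · rw [hsum]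
    set h := (t w).sum fun j a => a • c j with hh
    have hqp : dist q p < r := by
      have := dist_triangle q p' p
      rw [Metric.mem_ball] at hp'
      linarith
    have h1 : ‖(fderiv ℝ F q - fderiv ℝ F p) (v, h)‖ ≤ ε / 4 := by
      have h2 := (hrc hqp).le
      rw [dist_eq_norm] at h2
      have h3 : ‖(v, h)‖ ≤ max J 1 :=
        max_le (hv.trans (le_max_right _ _)) (hJw.trans (le_max_left _ _))
      calc _ ≤ ‖fderiv ℝ F q - fderiv ℝ F p‖ * ‖(v, h)‖ := ContinuousLinearMap.le_opNorm _ _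
        _ ≤ ε / (4 * max J 1) * max J 1 := by gcongr
        _ = ε / 4 := by field_simp
    have h4 : ‖T v - w‖ < ε / 4 := by simpa [dist_eq_norm] using hvw
    have h5 := ht w
    have e : fderiv ℝ F q (v, h) = (fderiv ℝ F q - fderiv ℝ F p) (v, h) + (T v - w) +
        (w + fderiv ℝ F p (0, h)) := by
      have : fderiv ℝ F p (v, h) = T v + fderiv ℝ F p (0, h) := by
        rw [hT, ContinuousLinearMap.comp_apply, ContinuousLinearMap.inl_apply, ← map_add]
        simp
      rw [sub_apply, this]
      abel
    rw [e]
    refine (norm_add₃_le).trans ?_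
    linarith

lemma exists_controls {F : H × E → H} (hF : ContDiff ℝ 1 F) {Z : Set (H × E)} (hZ : IsCompact Z)
    (hcomp : ∀ p ∈ Z, IsCompactOperator (fun v : H => fderiv ℝ F p (v, 0)))
    (hdense : ∀ p ∈ Z, DenseRange (fun h : E => fderiv ℝ F p (0, h))) {c : ℕ → E}
    (hc : Dense (Submodule.span ℝ (range c) : Set E)) {ε : ℝ} (hε : 0 < ε) :
    ∃ (M : ℕ) (A r : ℝ), 0 < r ∧ Controls F c ε Z M A r := by
  refine hZ.induction_on (p := fun Z => ∃ (M : ℕ) (A r : ℝ), 0 < r ∧ Controls F c ε Z M A r)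
    ?_ ?_ ?_ ?_
  · exact ⟨0, 0, 1, one_pos, fun p hp => hp.elim⟩
  · rintro s s' hs ⟨M, A, r, hr, h⟩
    exact ⟨M, A, r, hr, h.mono hs le_rfl le_rfl le_rfl⟩
  · rintro s s' ⟨M, A, r, hr, h⟩ ⟨M', A', r', hr', h'⟩
    refine ⟨max M M', max A A', min r r', lt_min hr hr', ?_⟩
    rintro p (hp | hp)
    · exact h.mono (Subset.refl _) (le_max_left _ _) (le_max_left _ _) (min_le_left _ _) p hp
    · exact h'.mono (Subset.refl _) (le_max_right _ _) (le_max_right _ _) (min_le_right _ _) p hp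
  · intro p hp
    obtain ⟨M, A, r, hr, h⟩ := exists_controls_nhds hF (hcomp p hp) (hdense p hp) hc hε
    exact ⟨_, mem_nhdsWithin_of_mem_nhds (Metric.ball_mem_nhds p hr), M, A, r, hr, h⟩

end Control

/-! ### Noise series in an orthonormal basis -/

section Basis

variable {E : Type*} [NormedAddCommGroup E] [InnerProductSpace ℝ E]

lemma dense_span_smul (e : HilbertBasis ℕ ℝ E) {b : ℕ → ℝ} (hb : ∀ j, b j ≠ 0) :
    Dense (Submodule.span ℝ (range fun j => b j • e j) : Set E) := by
  have h : Submodule.span ℝ (range fun j => b j • e j) = Submodule.span ℝ (range e) := by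
    refine le_antisymm (Submodule.span_le.2 ?_) (Submodule.span_le.2 ?_)
    · rintro _ ⟨j, rfl⟩
      exact Submodule.smul_mem _ _ (Submodule.subset_span ⟨j, rfl⟩)
    · rintro _ ⟨j, rfl⟩
      have : e j = (b j)⁻¹ • (b j • e j) := by rw [smul_smul, inv_mul_cancel₀ (hb j), one_smul]
      rw [this]
      exact Submodule.smul_mem _ _ (Submodule.subset_span ⟨j, rfl⟩)
  rw [h, dense_iff_closure_eq, ← Submodule.topologicalClosure_coe, e.dense_span]
  rfl

lemma hasSum_sq_of_hasSum (e : HilbertBasis ℕ ℝ E) {a : ℕ → ℝ} {z : E}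
    (h : HasSum (fun j => a j • e j) z) : HasSum (fun j => a j ^ 2) (‖z‖ ^ 2) := by
  have hcoord : ∀ i, inner ℝ (e i) z = a i := by
    intro i
    have h1 := h.mapL (innerSL ℝ (e i))
    refine h1.unique ?_
    have hfun : (fun j => innerSL ℝ (e i) (a j • e j)) = fun j => if j = i then a i else 0 := by
      ext j
      rw [innerSL_apply_apply, inner_smul_right, orthonormal_iff_ite.1 e.orthonormal]
      by_cases hj : j = i
      · subst hj; simp
      · simp [hj, Ne.symm hj]
    rw [hfun]
    exact hasSum_ite_eq i (a i)
  have h2 := e.hasSum_inner_mul_inner z z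
  rw [real_inner_self_eq_norm_sq] at h2
  have hfun : (fun j => a j ^ 2) = fun j => inner ℝ z (e j) * inner ℝ (e j) z := by
    ext j
    rw [real_inner_comm, hcoord, sq]
  rw [hfun]
  exact h2

/-- Series with small first coefficients and bounded remaining ones have a small sum. -/
lemma exists_norm_lt_of_coeff (e : HilbertBasis ℕ ℝ E) {b : ℕ → ℝ}
    (hb : Summable fun j => b j ^ 2) {r : ℝ} (hr : 0 < r) (M₀ : ℕ) :
    ∃ M ≥ M₀, ∃ τ > 0, ∀ a : ℕ → ℝ, (∀ j, |a j| ≤ 2) → (∀ j < M, |a j| ≤ τ) →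
      ∀ z : E, HasSum (fun j => a j • (b j • e j)) z → ‖z‖ < r := by
  -- The bound `2` on the coefficients allows for differences of two noise coefficients. Squared, it
  -- turns the tail `r ^ 2 / 8` into `r ^ 2 / 2`, and `τ` is chosen so that the head contributes at
  -- most the other half.
  obtain ⟨M, hM, htail⟩ : ∃ M ≥ M₀, ∑' j, b (j + M) ^ 2 < r ^ 2 / 8 :=
    ((tendsto_sum_nat_add fun j => b j ^ 2).eventually (gt_mem_nhds (by positivity))).and
      (Filter.eventually_ge_atTop M₀) |>.exists.imp fun _ h => ⟨h.2, h.1⟩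
  set D := ∑ j ∈ Finset.range M, b j ^ 2 with hD
  have hD0 : 0 ≤ D := Finset.sum_nonneg fun _ _ => sq_nonneg _
  refine ⟨M, hM, Real.sqrt (r ^ 2 / (2 * (D + 1))), by positivity, fun a ha2 haτ z hz => ?_⟩
  have hz' := hasSum_sq_of_hasSum e (a := fun j => a j * b j) (by simpa [smul_smul] using hz)
  have hsum := hz'.summable
  have htl := (summable_nat_add_iff M).2 hb
  have h1 : ∑ j ∈ Finset.range M, (a j * b j) ^ 2 ≤ r ^ 2 / (2 * (D + 1)) * D := by
    rw [hD, Finset.mul_sum]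
    refine Finset.sum_le_sum fun j hj => ?_
    rw [mul_pow]
    refine mul_le_mul_of_nonneg_right ?_ (sq_nonneg _)
    rw [← sq_abs]
    exact Real.le_sqrt (abs_nonneg _) (by positivity) |>.1 (haτ j (Finset.mem_range.1 hj))
  have h2 : ∑' j, (a (j + M) * b (j + M)) ^ 2 ≤ 4 * ∑' j, b (j + M) ^ 2 := by
    rw [← tsum_mul_left]
    refine ((summable_nat_add_iff M).2 hsum).tsum_le_tsum (fun j => ?_) (htl.mul_left 4)
    rw [mul_pow]
    refine mul_le_mul_of_nonneg_right ?_ (sq_nonneg _)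
    rw [← sq_abs]
    nlinarith [ha2 (j + M), abs_nonneg (a (j + M))]
  have h3 : r ^ 2 / (2 * (D + 1)) * D ≤ r ^ 2 / 2 := by
    rw [div_mul_eq_mul_div, div_le_div_iff₀ (by positivity) (by positivity)]
    nlinarith [sq_nonneg r]
  have h4 := hsum.sum_add_tsum_nat_add M
  rw [hz'.tsum_eq] at h4
  refine lt_of_pow_lt_pow_left₀ 2 hr.le ?_
  linarith

end Basis

/-! ### Cells of noise values and displacement along a control -/

/-- The only cell containing `x` is the one with index `⌊x * N⌋`. The index `k = N` is needed
because the cells are half-open and `x = 1` is allowed. -/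
lemma sum_indicator_Ico_div {N : ℕ} (hN : 0 < N) {x : ℝ} (hx : |x| ≤ 1) :
    ∑ k ∈ Finset.Icc (-N : ℤ) N,
      (Ico ((k : ℝ) / N) ((k + 1 : ℝ) / N)).indicator (1 : ℝ → ℝ) x = 1 := by
  have hN' : (0 : ℝ) < N := by exact_mod_cast hN
  have hmem : ∀ k : ℤ, x ∈ Ico ((k : ℝ) / N) ((k + 1 : ℝ) / N) ↔ ⌊x * N⌋ = k := by
    intro k
    rw [mem_Ico, div_le_iff₀ hN', lt_div_iff₀ hN', Int.floor_eq_iff]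
  rw [Finset.sum_eq_single ⌊x * N⌋]
  · rw [indicator_of_mem ((hmem _).2 rfl)]
    rfl
  · intro k _ hk
    exact indicator_of_notMem (fun h => hk ((hmem k).1 h).symm) _
  · intro h
    refine absurd (Finset.mem_Icc.2 ⟨?_, ?_⟩) h
    · rw [Int.le_floor]
      push_cast
      nlinarith [abs_le.1 hx]
    · rw [← Int.lt_add_one_iff, Int.floor_lt]
      push_cast
      nlinarith [abs_le.1 hx]

lemma norm_sub_le_of_norm_fderiv_le {G H : Type*} [NormedAddCommGroup G] [NormedSpace ℝ G]
    [NormedAddCommGroup H] [NormedSpace ℝ H] {F : G → H} (hF : Differentiable ℝ F) (p d : G)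
    {C : ℝ} (h : ∀ s ∈ Icc (0 : ℝ) 1, ‖fderiv ℝ F (p + s • d) d‖ ≤ C) :
    ‖F (p + d) - F p‖ ≤ C := by
  have hd : ∀ s : ℝ, HasDerivAt (fun s : ℝ => F (p + s • d)) (fderiv ℝ F (p + s • d) d) s := by
    intro s
    have h1 : HasDerivAt (fun s : ℝ => p + s • d) d s := by
      simpa using ((hasDerivAt_id s).smul_const d).const_add p
    exact (hF (p + s • d)).hasFDerivAt.comp_hasDerivAt s h1
  simpa using norm_image_sub_le_of_norm_deriv_le_segment_01'
    (fun s _ => (hd s).hasDerivWithinAt) (fun s hs => h s (Ico_subset_Icc_self hs))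

/-- A small translation of the noise along an approximate control moves the image of `u` to the
image of `u'`, up to an error `ε ‖u' - u‖`. -/
lemma norm_sub_le_of_control {H E : Type*} [NormedAddCommGroup H] [NormedSpace ℝ H]
    [NormedAddCommGroup E] [NormedSpace ℝ E] {F : H × E → H} (hF : Differentiable ℝ F) {p : H × E} {ε r J : ℝ}
    {v : H} {h ζ : E} (hctrl : ∀ q, dist q p < r → ‖fderiv ℝ F q (v, h)‖ ≤ ε)
    (hv : ‖v‖ ≤ 1) (hh : ‖h‖ ≤ J) {s : ℝ} (hs : 0 ≤ s) (hsr : s * (1 + J) < r / 2)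
    (hζ : ‖ζ - p.2‖ < r / 2) :
    ‖F (p.1 + s • v, ζ + s • h) - F (p.1, ζ)‖ ≤ s * ε := by
  have hJ : 0 ≤ J := (norm_nonneg _).trans hh
  have hr : 0 < r / 2 := (norm_nonneg _).trans_lt hζ
  refine norm_sub_le_of_norm_fderiv_le hF (p.1, ζ) (s • v, s • h) fun σ hσ => ?_
  have e : ((s • v, s • h) : H × E) = s • (v, h) := rfl
  rw [e, map_smul, norm_smul, Real.norm_of_nonneg hs]
  refine mul_le_mul_of_nonneg_left (hctrl _ ?_) hs
  have h1 : ‖σ • s • v‖ ≤ s := by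
    rw [norm_smul, norm_smul, Real.norm_of_nonneg hs, Real.norm_of_nonneg hσ.1]
    calc σ * (s * ‖v‖) ≤ 1 * (s * 1) := by
          have := hσ.2
          gcongr
      _ = s := by ring
  have h2 : ‖σ • s • h‖ ≤ s * J := by
    rw [norm_smul, norm_smul, Real.norm_of_nonneg hs, Real.norm_of_nonneg hσ.1]
    calc σ * (s * ‖h‖) ≤ 1 * (s * J) := by
          have := hσ.2
          gcongr
      _ = s * J := by ring
  have h3 := mul_nonneg hs hJ
  rw [dist_eq_norm, Prod.norm_def]
  refine max_lt ?_ ?_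
  · have : ((p.1, ζ) + σ • s • ((v, h) : H × E) - p).1 = σ • s • v := by simp
    rw [this]
    linarith
  · have : ((p.1, ζ) + σ • s • ((v, h) : H × E) - p).2 = σ • s • h + (ζ - p.2) := by
      simp only [Prod.snd_sub, Prod.snd_add, Prod.smul_snd]
      abel
    rw [this]
    refine (norm_add_le _ _).trans_lt ?_
    linarith

/-! ### The one-step gradient estimate -/

section Gradient

variable {Ω : Type*} [MeasurableSpace Ω] {P : Measure Ω} [IsProbabilityMeasure P]
  {H E : Type*} [NormedAddCommGroup H] [NormedSpace ℝ H]
  [MeasurableSpace H] [BorelSpace H]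
  [NormedAddCommGroup E] [InnerProductSpace ℝ E] [CompleteSpace E]
  [SecondCountableTopology E] [MeasurableSpace E] [BorelSpace E]

/-- The contribution of one cell of noise values to the gradient estimate. -/
lemma abs_integral_cell_sub_le {ξ : ℕ → Ω → ℝ} (hξ : ∀ i, Measurable (ξ i))
    (hind : iIndepFun ξ P) (hbdd : ∀ i, ∀ᵐ ω ∂P, |ξ i ω| ≤ 1) {c : ℕ → E} {η : Ω → E}
    (hηm : Measurable η) (hη : ∀ᵐ ω ∂P, HasSum (fun j => ξ j ω • c j) (η ω))
    {K : Set E} (hK : ∀ᵐ ω ∂P, η ω ∈ K) {I : ℕ → Set ℝ}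
    (hI : ∀ j, MeasurableSet (I j)) {C : ℕ → ℝ} (hC0 : ∀ j, 0 ≤ C j)
    (hC : ∀ j, ShiftBound (P.map (ξ j)) (I j) (C j))
    {F : H × E → H} (hF : ContDiff ℝ 1 F) {X : Set H} {ε A r τ : ℝ} {M : ℕ} (hε : 0 ≤ ε)
    (hctrl : Controls F c ε (X ×ˢ K) M A r)
    (hIτ : ∀ j, ∀ x ∈ I j, ∀ y ∈ I j, |x - y| ≤ τ)
    (hτ : ∀ a : ℕ → ℝ, (∀ j, |a j| ≤ 2) → (∀ j < M, |a j| ≤ τ) →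
      ∀ z : E, HasSum (fun j => a j • c j) z → ‖z‖ < r / 2)
    {u u' : H} (hu : u ∈ X) (huu : ‖u' - u‖ * (1 + ∑ j ∈ Finset.range M, A * ‖c j‖) < r / 2)
    {g : H → ℝ} {L : NNReal} (hg : LipschitzWith L g) {B : ℝ} (hB : ∀ x, |g x| ≤ B) :
    |∫ ω, (∏ j ∈ Finset.range M, (I j).indicator (1 : ℝ → ℝ) (ξ j ω)) *
      (g (F (u, η ω)) - g (F (u', η ω))) ∂P| ≤
      (∑ j ∈ Finset.range M, C j * A) * B * ‖u' - u‖ +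
        (∫ ω, ∏ j ∈ Finset.range M, (I j).indicator (1 : ℝ → ℝ) (ξ j ω) ∂P) *
          (L * (‖u' - u‖ * ε)) := by
  set W : Ω → ℝ := fun ω => ∏ j ∈ Finset.range M, (I j).indicator (1 : ℝ → ℝ) (ξ j ω) with hW
  have hW01 : ∀ ω, 0 ≤ W ω ∧ W ω ≤ 1 := by
    intro ω
    have h0 : ∀ j, 0 ≤ (I j).indicator (1 : ℝ → ℝ) (ξ j ω) := fun j =>
      indicator_nonneg (fun _ _ => zero_le_one) _
    have h1 : ∀ j, (I j).indicator (1 : ℝ → ℝ) (ξ j ω) ≤ 1 := by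
      intro j
      by_cases hx : ξ j ω ∈ I j <;> simp [hx]
    exact ⟨Finset.prod_nonneg fun j _ => h0 j, Finset.prod_le_one (fun j _ => h0 j) fun j _ => h1 j⟩
  have hIm : ∀ j, Measurable ((I j).indicator (1 : ℝ → ℝ)) := fun j =>
    measurable_one.indicator (hI j)
  have hWm : Measurable W := by fun_prop
  have hWne : ∀ ω, W ω ≠ 0 → ∀ j < M, ξ j ω ∈ I j := by
    intro ω hω j hj
    by_contra hn
    exact hω (Finset.prod_eq_zero (Finset.mem_range.2 hj) (indicator_of_notMem hn _))
  have hB0 : 0 ≤ B := (abs_nonneg _).trans (hB 0)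
  have hgm : Measurable g := hg.continuous.measurable
  have hFm : Measurable F := hF.continuous.measurable
  have hWint : Integrable W P := Integrable.of_bound hWm.aestronglyMeasurable 1
    (Filter.Eventually.of_forall fun ω => by
      rw [Real.norm_of_nonneg (hW01 ω).1]; exact (hW01 ω).2)
  have hI0 : 0 ≤ ∫ ω, W ω ∂P := integral_nonneg fun ω => (hW01 ω).1
  have hall : ∀ᵐ ω ∂P, (∀ j, |ξ j ω| ≤ 1) ∧ HasSum (fun j => ξ j ω • c j) (η ω) ∧ η ω ∈ K := by
    filter_upwards [ae_all_iff.2 hbdd, hη, hK] with ω h1 h2 h3 using ⟨h1, h2, h3⟩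
  -- A typical noise value in the cell serves as base point for choosing the control. If there is
  -- none, the integrand vanishes almost surely, and only nonnegativity of the right side remains;
  -- `0 ≤ A` is then read off from a control for `v = 0`.
  by_cases hex : ∃ ω₀, W ω₀ ≠ 0 ∧ (∀ j, |ξ j ω₀| ≤ 1) ∧
      HasSum (fun j => ξ j ω₀ • c j) (η ω₀) ∧ η ω₀ ∈ K
  swap
  · have hz : ∀ᵐ ω ∂P, W ω * (g (F (u, η ω)) - g (F (u', η ω))) = 0 := by
      filter_upwards [hall] with ω hω
      by_contra hne
      exact hex ⟨ω, left_ne_zero_of_mul hne, hω⟩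
    rw [integral_congr_ae hz, integral_zero, abs_zero]
    by_cases hA : 0 ≤ A
    · have : 0 ≤ ∑ j ∈ Finset.range M, C j * A :=
        Finset.sum_nonneg fun j _ => mul_nonneg (hC0 j) hA
      positivity
    · exfalso
      obtain ⟨ω, hω⟩ := hall.exists
      obtain ⟨t, ht, -⟩ := hctrl (u, η ω) ⟨hu, hω.2.2⟩ 0 (by simp)
      exact hA ((abs_nonneg _).trans (ht 0))
  obtain ⟨ω₀, hW₀, hb₀, hs₀, hK₀⟩ := hex
  set s := ‖u' - u‖ with hs
  -- For `u' = u` this is `0` since `0⁻¹ = 0`, so no case distinction is needed in the use of the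
  -- control.
  set v := s⁻¹ • (u' - u) with hv
  have hs0 : 0 ≤ s := norm_nonneg _
  have hv1 : ‖v‖ ≤ 1 := by
    rw [hv, norm_smul, norm_inv, Real.norm_of_nonneg hs0, ← hs]
    exact inv_mul_le_one
  have hsv : u + s • v = u' := by
    rcases eq_or_ne s 0 with h0 | h0
    · have : u' - u = 0 := norm_eq_zero.1 (hs ▸ h0)
      rw [h0, zero_smul, add_zero]
      exact (sub_eq_zero.1 this).symm
    · rw [hv, smul_smul, mul_inv_cancel₀ h0, one_smul, add_sub_cancel]
  obtain ⟨t, htA, -, ht⟩ := hctrl (u, η ω₀) ⟨hu, hK₀⟩ v hv1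
  set h := ∑ j ∈ Finset.range M, t j • c j with hh
  have hhJ : ‖h‖ ≤ ∑ j ∈ Finset.range M, A * ‖c j‖ := by
    refine (norm_sum_le _ _).trans (Finset.sum_le_sum fun j _ => ?_)
    rw [norm_smul]
    exact mul_le_mul_of_nonneg_right (htA j) (norm_nonneg _)
  have hclose : ∀ᵐ ω ∂P, ‖W ω * (g (F (u, η ω)) - g (F (u', η ω + s • h)))‖ ≤
      W ω * (L * (s * ε)) := by
    filter_upwards [hall] with ω hω
    rw [norm_mul, Real.norm_of_nonneg (hW01 ω).1]
    rcases eq_or_ne (W ω) 0 with h0 | h0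
    · simp [h0]
    refine mul_le_mul_of_nonneg_left ?_ (hW01 ω).1
    have hζ : ‖η ω - η ω₀‖ < r / 2 := by
      refine hτ (fun j => ξ j ω - ξ j ω₀) (fun j => ?_) (fun j hj => ?_) _ ?_
      · have h1 := hω.1 j
        have h2 := hb₀ j
        refine (abs_sub _ _).trans ?_
        linarith
      · exact hIτ j _ (hWne ω h0 j hj) _ (hWne ω₀ hW₀ j hj)
      · simpa only [sub_smul] using hω.2.1.sub hs₀
    have h1 := norm_sub_le_of_control (hF.differentiable one_ne_zero) ht hv1 hhJ hs0 huu hζ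
    simp only [hsv] at h1
    rw [← dist_eq_norm]
    refine (hg.dist_le_mul _ _).trans ?_
    rw [dist_comm, dist_eq_norm]
    gcongr
  have hcost := abs_integral_cell_shift_le hξ hind hηm hη hI hC
    (G := fun ζ => g (F (u', ζ))) (by fun_prop) (fun ζ => hB _) (fun j => s * t j) M M le_rfl
  have hsh : ∑ j ∈ Finset.range M, (s * t j) • c j = s • h := by
    rw [hh, Finset.smul_sum]
    simp only [smul_smul]
  rw [hsh] at hcost
  have hint : ∀ f f' : Ω → H, Measurable f → Measurable f' →
      Integrable (fun ω => W ω * (g (f ω) - g (f' ω))) P := by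
    intro f f' hf hf'
    refine Integrable.of_bound (C := 1 * (B + B)) (by fun_prop)
      (Filter.Eventually.of_forall fun ω => ?_)
    rw [norm_mul, Real.norm_of_nonneg (hW01 ω).1]
    exact mul_le_mul (hW01 ω).2 ((norm_sub_le _ _).trans (add_le_add (hB _) (hB _)))
      (norm_nonneg _) zero_le_one
  -- The first term is the cost of translating the noise with the state `u'` fixed; the second
  -- compares `F (u, η)` with the controlled image of `u'`, pointwise on the cell.
  have hsplit : ∫ ω, W ω * (g (F (u, η ω)) - g (F (u', η ω))) ∂P =
      ∫ ω, W ω * (g (F (u', η ω + s • h)) - g (F (u', η ω))) ∂P +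
        ∫ ω, W ω * (g (F (u, η ω)) - g (F (u', η ω + s • h))) ∂P := by
    rw [← integral_add (hint _ _ (by fun_prop) (by fun_prop))
      (hint _ _ (by fun_prop) (by fun_prop))]
    congr 1
    ext ω
    ring
  rw [hsplit]
  refine (abs_add_le _ _).trans (add_le_add (hcost.trans ?_) ?_)
  · rw [mul_right_comm _ B s, Finset.sum_mul _ (fun j => C j * A) s]
    refine mul_le_mul_of_nonneg_right (Finset.sum_le_sum fun j _ => ?_) hB0
    rw [abs_mul, abs_of_nonneg hs0, mul_assoc]
    refine mul_le_mul_of_nonneg_left ?_ (hC0 j)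
    rw [mul_comm]
    exact mul_le_mul_of_nonneg_right (htA j) hs0
  · rw [← integral_mul_const]
    exact norm_integral_le_of_norm_le (hWint.mul_const _) hclose

/-- One-step gradient estimate: the expectation of a bounded Lipschitz function gains a small factor
in front of its Lipschitz constant. -/
lemma exists_gradient_bound {ξ : ℕ → Ω → ℝ} (hξ : ∀ i, Measurable (ξ i))
    (hind : iIndepFun ξ P) (hbdd : ∀ i, ∀ᵐ ω ∂P, |ξ i ω| ≤ 1) {ρ : ℕ → ℝ → ℝ}
    (hρ : ∀ j, (∀ r, 0 ≤ ρ j r) ∧ ∃ L, LipschitzWith L (ρ j))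
    (hlaw : ∀ j, P.map (ξ j) = volume.withDensity (fun r => ENNReal.ofReal (ρ j r)))
    (e : HilbertBasis ℕ ℝ E) {b : ℕ → ℝ} (hb0 : ∀ j, b j ≠ 0) (hb : Summable fun j => b j ^ 2)
    {η : Ω → E} (hηm : Measurable η)
    (hη : ∀ᵐ ω ∂P, HasSum (fun j => ξ j ω • (b j • e j)) (η ω))
    {K : Set E} (hKc : IsCompact K) (hK : ∀ᵐ ω ∂P, η ω ∈ K)
    {F : H × E → H} (hF : ContDiff ℝ 1 F) {X : Set H} (hX : IsCompact X)
    (hcomp : ∀ p ∈ X ×ˢ K, IsCompactOperator (fun v : H => fderiv ℝ F p (v, 0)))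
    (hdense : ∀ p ∈ X ×ˢ K, DenseRange (fun h : E => fderiv ℝ F p (0, h)))
    {ε : ℝ} (hε : 0 < ε) :
    ∃ C δ : ℝ, 0 ≤ C ∧ 0 < δ ∧ ∀ u ∈ X, ∀ u' : H, ‖u' - u‖ ≤ δ →
      ∀ (g : H → ℝ) (L : NNReal) (B : ℝ), LipschitzWith L g → (∀ x, |g x| ≤ B) →
        |∫ ω, g (F (u, η ω)) ∂P - ∫ ω, g (F (u', η ω)) ∂P| ≤ (C * B + L * ε) * ‖u' - u‖ := by
  set c : ℕ → E := fun j => b j • e j with hc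
  obtain ⟨M₀, A₀, r, hr, hctrl₀⟩ := exists_controls hF (hX.prod hKc) hcomp hdense
    (dense_span_smul e hb0) hε
  obtain ⟨M, hM, τ, hτ0, hτ⟩ := exists_norm_lt_of_coeff e hb (half_pos hr) M₀
  set A := max A₀ 0 with hA
  have hA0 : 0 ≤ A := le_max_right _ _
  have hctrl := hctrl₀.mono (Subset.refl _) hM (le_max_left A₀ 0) le_rfl
  obtain ⟨n, hn⟩ := exists_nat_one_div_lt hτ0
  set N := n + 1 with hN
  have hNpos : 0 < N := Nat.succ_pos n
  have hN' : (0 : ℝ) < N := by exact_mod_cast hNpos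
  set J : ℤ → Set ℝ := fun k => Ico ((k : ℝ) / N) ((k + 1 : ℝ) / N) with hJ
  have hJm : ∀ k, MeasurableSet (J k) := fun k => measurableSet_Ico
  have hJτ : ∀ k, ∀ x ∈ J k, ∀ y ∈ J k, |x - y| ≤ τ := by
    intro k x hx y hy
    have h1 : (k + 1 : ℝ) / N = k / N + 1 / N := add_div _ _ _
    have h2 : (1 : ℝ) / N < τ := by simpa [hN] using hn
    simp only [hJ, mem_Ico, h1] at hx hy
    rw [abs_le]
    constructor <;> linarith
  have hCex : ∀ (j : ℕ) (k : ℤ), ∃ C, 0 ≤ C ∧ ShiftBound (P.map (ξ j)) (J k) C := by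
    intro j k
    obtain ⟨hnn, L, hL⟩ := hρ j
    rw [hlaw j]
    exact exists_shiftBound hnn hL _ _
  choose Cs hCs0 hCs using hCex
  set cells : Finset (Fin M → ℤ) := Fintype.piFinset fun _ => Finset.Icc (-N : ℤ) N with hcells
  -- The default index `0` beyond `M` plays no role: only the first `M` coordinates are cut into
  -- cells.
  set cellIdx : (Fin M → ℤ) → ℕ → ℤ := fun κ j => if h : j < M then κ ⟨j, h⟩ else 0 with hcellIdx
  set W : (Fin M → ℤ) → Ω → ℝ := fun κ ω =>
    ∏ j ∈ Finset.range M, (J (cellIdx κ j)).indicator (1 : ℝ → ℝ) (ξ j ω) with hW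
  have hWsum : ∀ᵐ ω ∂P, ∑ κ ∈ cells, W κ ω = 1 := by
    filter_upwards [ae_all_iff.2 hbdd] with ω hω
    have h1 : ∀ κ, W κ ω = ∏ i : Fin M, (J (κ i)).indicator (1 : ℝ → ℝ) (ξ i ω) := by
      intro κ
      simp only [hW]
      rw [Finset.prod_range]
      simp [hcellIdx]
    simp only [h1]
    rw [hcells, ← Finset.prod_univ_sum (fun _ : Fin M => Finset.Icc (-N : ℤ) N)
      (fun i k => (J k).indicator (1 : ℝ → ℝ) (ξ i ω))]
    exact Finset.prod_eq_one fun i _ => sum_indicator_Ico_div hNpos (hω i)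
  set Ctot := ∑ κ ∈ cells, ∑ j ∈ Finset.range M, Cs j (cellIdx κ j) * A with hCtot
  set D := 1 + ∑ j ∈ Finset.range M, A * ‖c j‖ with hD
  have hD0 : 0 < D := by
    have : 0 ≤ ∑ j ∈ Finset.range M, A * ‖c j‖ := Finset.sum_nonneg fun j _ => by positivity
    positivity
  refine ⟨Ctot, r / (4 * D), Finset.sum_nonneg fun κ _ => Finset.sum_nonneg fun j _ =>
    mul_nonneg (hCs0 _ _) hA0, by positivity, fun u hu u' huu g L B hg hB => ?_⟩
  have huu' : ‖u' - u‖ * D < r / 2 := by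
    rw [le_div_iff₀ (by positivity)] at huu
    linarith
  have hcell := fun κ => abs_integral_cell_sub_le hξ hind hbdd hηm hη hK
    (I := fun j => J (cellIdx κ j)) (fun j => hJm _) (C := fun j => Cs j (cellIdx κ j))
    (fun j => hCs0 _ _) (fun j => hCs _ _) hF hε.le hctrl (fun j => hJτ _) hτ hu huu' hg hB
  have hgm : Measurable g := hg.continuous.measurable
  have hFm : Measurable F := hF.continuous.measurable
  have hIm : ∀ k, Measurable ((J k).indicator (1 : ℝ → ℝ)) := fun k =>
    measurable_one.indicator (hJm k)
  have hWm : ∀ κ, Measurable (W κ) := fun κ => by fun_prop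
  have hW1 : ∀ κ ω, ‖W κ ω‖ ≤ 1 := by
    intro κ ω
    rw [hW, norm_prod]
    refine Finset.prod_le_one (fun _ _ => norm_nonneg _) fun j _ => ?_
    by_cases hx : ξ j ω ∈ J (cellIdx κ j) <;> simp [hx]
  have hgi : ∀ w : H, Integrable (fun ω => g (F (w, η ω))) P := fun w =>
    Integrable.of_bound (C := B)
      (hgm.comp (hFm.comp (measurable_const.prodMk hηm))).aestronglyMeasurable
      (Filter.Eventually.of_forall fun ω => hB _)
  have hWi : ∀ κ, Integrable (W κ) P := fun κ =>
    Integrable.of_bound (hWm κ).aestronglyMeasurable 1 (Filter.Eventually.of_forall (hW1 κ))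
  have hprodi : ∀ κ, Integrable (fun ω => W κ ω * (g (F (u, η ω)) - g (F (u', η ω)))) P :=
    fun κ => ((hgi u).sub (hgi u')).bdd_mul (hWm κ).aestronglyMeasurable
      (Filter.Eventually.of_forall (hW1 κ))
  have hsplit : ∫ ω, g (F (u, η ω)) ∂P - ∫ ω, g (F (u', η ω)) ∂P =
      ∑ κ ∈ cells, ∫ ω, W κ ω * (g (F (u, η ω)) - g (F (u', η ω))) ∂P := by
    rw [← integral_sub (hgi u) (hgi u'), ← integral_finsetSum _ fun κ _ => hprodi κ]
    refine integral_congr_ae ?_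
    filter_upwards [hWsum] with ω hω
    rw [← Finset.sum_mul, hω, one_mul]
  -- The approximation errors are weighted by the cell probabilities, so their sum is `L * ε`
  -- however fine the partition; only the constant in front of `B` grows with the number of cells.
  have hone : ∑ κ ∈ cells, ∫ ω, W κ ω ∂P = 1 := by
    rw [← integral_finsetSum _ fun κ _ => hWi κ, integral_congr_ae hWsum]
    simp
  rw [hsplit]
  calc _ ≤ ∑ κ ∈ cells, |∫ ω, W κ ω * (g (F (u, η ω)) - g (F (u', η ω))) ∂P| :=
        Finset.abs_sum_le_sum_abs _ _
    _ ≤ ∑ κ ∈ cells, ((∑ j ∈ Finset.range M, Cs j (cellIdx κ j) * A) * B * ‖u' - u‖ +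
        (∫ ω, W κ ω ∂P) * (L * (‖u' - u‖ * ε))) := Finset.sum_le_sum fun κ _ => hcell κ
    _ = (Ctot * B + L * ε) * ‖u' - u‖ := by
        rw [Finset.sum_add_distrib, ← Finset.sum_mul, ← Finset.sum_mul, ← Finset.sum_mul, hone,
          ← hCtot]
        ring

end Gradient

/-! ### Markov operator and the truncated metric -/

/-- The Markov operator of the random dynamical system `u ↦ F (u, ζ)`, `ζ` with law `ℓ`. -/
noncomputable def markovOp {H E : Type*} [MeasurableSpace E] (ℓ : Measure E) (F : H × E → H)
    (f : H → ℝ) : H → ℝ :=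
  fun u => ∫ ζ, f (F (u, ζ)) ∂ℓ

/-- Measurable observables bounded by `1` that are `c`-Lipschitz on `X` for the metric
`min 1 (‖x - y‖ / δ)`. -/
def Observable {H : Type*} [NormedAddCommGroup H] [MeasurableSpace H] (X : Set H) (δ c : ℝ)
    (f : H → ℝ) : Prop :=
  Measurable f ∧ (∀ x, |f x| ≤ 1) ∧ ∀ x ∈ X, ∀ y ∈ X, |f x - f y| ≤ c * min 1 (‖x - y‖ / δ)

lemma abs_markovOp_le {H E : Type*} [MeasurableSpace E] {ℓ : Measure E} [IsProbabilityMeasure ℓ]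
    {F : H × E → H} {f : H → ℝ} (hf : ∀ x, |f x| ≤ 1) (u : H) : |markovOp ℓ F f u| ≤ 1 :=
  (norm_integral_le_of_norm_le_const (μ := ℓ) (f := fun ζ => f (F (u, ζ)))
    (Filter.Eventually.of_forall fun ζ => hf _)).trans_eq (by simp)

lemma measurable_markovOp {H E : Type*} [MeasurableSpace H] [MeasurableSpace E] {ℓ : Measure E}
    [IsProbabilityMeasure ℓ] {F : H × E → H} (hF : Measurable F) {f : H → ℝ} (hf : Measurable f) :
    Measurable (markovOp ℓ F f) :=
  (StronglyMeasurable.integral_prod_right (f := fun u ζ => f (F (u, ζ)))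
    (hf.comp hF).stronglyMeasurable).measurable

lemma integrable_comp_section {H E : Type*} [MeasurableSpace H] [MeasurableSpace E] {ℓ : Measure E}
    [IsProbabilityMeasure ℓ] {F : H × E → H} (hF : Measurable F) {f : H → ℝ} (hf : Measurable f)
    {B : ℝ} (hB : ∀ x, |f x| ≤ B) (u : H) : Integrable (fun ζ => f (F (u, ζ))) ℓ :=
  Integrable.of_bound (C := B) (hf.comp (hF.comp (measurable_const.prodMk
    measurable_id))).aestronglyMeasurable (Filter.Eventually.of_forall fun _ => hB _)

/-- One-step smoothing of the Markov operator on the set `X`. -/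
def GradientBound {H E : Type*} [NormedAddCommGroup H] [MeasurableSpace E] (ℓ : Measure E)
    (F : H × E → H) (X : Set H) (C δ : ℝ) : Prop :=
  ∀ u ∈ X, ∀ u' ∈ X, ‖u' - u‖ ≤ δ →
    ∀ (g : H → ℝ) (L : NNReal) (B : ℝ), LipschitzWith L g → (∀ x, |g x| ≤ B) →
      |markovOp ℓ F g u - markovOp ℓ F g u'| ≤ (C * B + L * (1 / 4)) * ‖u' - u‖

section Smoothing

variable {H E : Type*} [NormedAddCommGroup H] [MeasurableSpace H] [MeasurableSpace E]
  {ℓ : Measure E} [IsProbabilityMeasure ℓ] {F : H × E → H} {X : Set H} {K : Set E}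

/-- The gradient estimate requires globally Lipschitz functions. Subtracting `f u` makes the sup
norm on `X` at most `c` instead of `1`, and truncating a Lipschitz extension at height `c` preserves
both bounds. -/
lemma exists_lipschitz_extension {δ c : ℝ} (hδ : 0 < δ) (hc : 0 ≤ c) {f : H → ℝ}
    (hf : Observable X δ c f) {u : H} (hu : u ∈ X) :
    ∃ g : H → ℝ, LipschitzWith (c / δ).toNNReal g ∧ (∀ x, |g x| ≤ c) ∧
      ∀ x ∈ X, f x = g x + f u := by
  have hlip : LipschitzOnWith (c / δ).toNNReal (fun x => f x - f u) X := by
    refine LipschitzOnWith.of_dist_le_mul fun x hx y hy => ?_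
    rw [Real.coe_toNNReal _ (by positivity), Real.dist_eq, dist_eq_norm, sub_sub_sub_cancel_right]
    calc _ ≤ c * min 1 (‖x - y‖ / δ) := hf.2.2 x hx y hy
      _ ≤ c * (‖x - y‖ / δ) := mul_le_mul_of_nonneg_left (min_le_right _ _) hc
      _ = c / δ * ‖x - y‖ := by ring
  obtain ⟨g, hg, hgX⟩ := hlip.extend_real
  refine ⟨fun x => max (-c) (min c (g x)), (hg.const_min c).const_max (-c), fun x => ?_,
    fun x hx => ?_⟩
  · rw [abs_le]
    exact ⟨le_max_left _ _, max_le (by linarith) (min_le_left _ _)⟩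
  · have h1 : |g x| ≤ c := by
      rw [← hgX hx]
      exact (hf.2.2 x hx u hu).trans (mul_le_of_le_one_right hc (min_le_left _ _))
    rw [abs_le] at h1
    have h2 := hgX hx
    simp only at h2
    change f x = max (-c) (min c (g x)) + f u
    rw [min_eq_right h1.2, max_eq_right h1.1, ← h2]
    ring

variable [BorelSpace H]

/-- Constants are fixed by the Markov operator, so the gradient estimate may be applied to `f - f
u`, whose sup norm and slope are both proportional to `c`. This is what halves the slope. -/
lemma Observable.abs_markovOp_sub_le_of_near (hF : Measurable F) (hK : ∀ᵐ ζ ∂ℓ, ζ ∈ K)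
    (hinv : ∀ u ∈ X, ∀ ζ ∈ K, F (u, ζ) ∈ X) {C δ₀ δ c : ℝ} (hgrad : GradientBound ℓ F X C δ₀)
    (hδ : 0 < δ) (hδ₀ : δ ≤ δ₀) (hCδ : C * δ ≤ 1 / 4) (hc : 0 ≤ c) {f : H → ℝ}
    (hf : Observable X δ c f) {u u' : H} (hu : u ∈ X) (hu' : u' ∈ X) (huu : ‖u - u'‖ ≤ δ) :
    |markovOp ℓ F f u - markovOp ℓ F f u'| ≤ c / 2 * (‖u - u'‖ / δ) := by
  obtain ⟨g, hg, hgc, hfg⟩ := exists_lipschitz_extension hδ hc hf hu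
  have hmk : ∀ w ∈ X, markovOp ℓ F f w = markovOp ℓ F g w + f u := by
    intro w hw
    have h1 : ∫ ζ, f (F (w, ζ)) ∂ℓ = ∫ ζ, (g (F (w, ζ)) + f u) ∂ℓ := by
      refine integral_congr_ae ?_
      filter_upwards [hK] with ζ hζ using hfg _ (hinv w hw ζ hζ)
    rw [markovOp, h1, integral_add (integrable_comp_section hF hg.continuous.measurable hgc w)
      (integrable_const _)]
    simp [markovOp]
  rw [norm_sub_rev] at huu
  have h := hgrad u hu u' hu' (huu.trans hδ₀) g _ c hg hgc
  rw [hmk u hu, hmk u' hu', add_sub_add_right_eq_sub]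
  refine h.trans ?_
  rw [Real.coe_toNNReal _ (by positivity), norm_sub_rev u u']
  -- In units of `c / δ` both terms are at most `1 / 4`: the first by `C * δ ≤ 1 / 4`, the second by
  -- the choice of `ε`.
  have h2 : C * c + c / δ * (1 / 4) ≤ c / 2 / δ := by
    rw [div_div, le_div_iff₀ (by positivity)]
    have : (C * c + c / δ * (1 / 4)) * (2 * δ) = 2 * c * (C * δ) + c / 2 := by
      field_simp
      ring
    rw [this]
    nlinarith
  calc _ ≤ c / 2 / δ * ‖u' - u‖ := mul_le_mul_of_nonneg_right h2 (norm_nonneg _)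
    _ = _ := by ring

/-- Near pairs gain a factor `1 / 2`; for far pairs the oscillation of `f` on the invariant set `X`
is at most `c`, which is only preserved. -/
lemma Observable.markovOp (hF : Measurable F) (hK : ∀ᵐ ζ ∂ℓ, ζ ∈ K)
    (hinv : ∀ u ∈ X, ∀ ζ ∈ K, F (u, ζ) ∈ X) {C δ₀ δ c : ℝ} (hgrad : GradientBound ℓ F X C δ₀)
    (hδ : 0 < δ) (hδ₀ : δ ≤ δ₀) (hCδ : C * δ ≤ 1 / 4) (hc : 0 ≤ c) {f : H → ℝ}
    (hf : Observable X δ c f) : Observable X δ c (markovOp ℓ F f) := by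
  refine ⟨measurable_markovOp hF hf.1, abs_markovOp_le hf.2.1, fun u hu u' hu' => ?_⟩
  rcases le_or_gt ‖u - u'‖ δ with h | h
  · have h1 : ‖u - u'‖ / δ ≤ 1 := (div_le_one hδ).2 h
    rw [min_eq_right h1]
    refine (hf.abs_markovOp_sub_le_of_near hF hK hinv hgrad hδ hδ₀ hCδ hc hu hu' h).trans ?_
    exact mul_le_mul_of_nonneg_right (by linarith) (by positivity)
  · have h1 : 1 ≤ ‖u - u'‖ / δ := (one_le_div hδ).2 h.le
    rw [min_eq_left h1, mul_one]
    have hi := integrable_comp_section (ℓ := ℓ) hF hf.1 hf.2.1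
    rw [RDS.markovOp, RDS.markovOp, ← integral_sub (hi u) (hi u')]
    have hle : ∀ᵐ ζ ∂ℓ, ‖f (F (u, ζ)) - f (F (u', ζ))‖ ≤ c := by
      filter_upwards [hK] with ζ hζ
      exact (hf.2.2 _ (hinv u hu ζ hζ) _ (hinv u' hu' ζ hζ)).trans
        (mul_le_of_le_one_right hc (min_le_left _ _))
    simpa using norm_integral_le_of_norm_le_const hle

lemma Observable.iterate_markovOp (hF : Measurable F) (hK : ∀ᵐ ζ ∂ℓ, ζ ∈ K)
    (hinv : ∀ u ∈ X, ∀ ζ ∈ K, F (u, ζ) ∈ X) {C δ₀ δ c : ℝ} (hgrad : GradientBound ℓ F X C δ₀)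
    (hδ : 0 < δ) (hδ₀ : δ ≤ δ₀) (hCδ : C * δ ≤ 1 / 4) (hc : 0 ≤ c) {f : H → ℝ}
    (hf : Observable X δ c f) (k : ℕ) : Observable X δ c ((RDS.markovOp ℓ F)^[k] f) := by
  induction k with
  | zero => exact hf
  | succ k ih =>
    rw [Function.iterate_succ_apply']
    exact ih.markovOp hF hK hinv hgrad hδ hδ₀ hCδ hc

end Smoothing

/-! ### Contraction by a common-noise coupling -/

section Contraction

variable {H E : Type*} [NormedAddCommGroup H] [MeasurableSpace H]
  [NormedAddCommGroup E] [MeasurableSpace E] [OpensMeasurableSpace E]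
  {ℓ : Measure E} [IsProbabilityMeasure ℓ] {F : H × E → H} {X : Set H} {K : Set E}

/-- Running two copies with the same noise: closeness near the origin propagates outwards. -/
lemma abs_markovOp_sub_le_of_ball (hF : Measurable F) (hK : ∀ᵐ ζ ∂ℓ, ζ ∈ K)
    (hinv : ∀ u ∈ X, ∀ ζ ∈ K, F (u, ζ) ∈ X) {γ Λ θ s s' a c : ℝ} (hγ : 0 ≤ γ) (hΛ : 0 ≤ Λ)
    (hdis : ∀ u ∈ X, ∀ ζ ∈ K, ‖F (u, ζ)‖ ≤ γ * ‖u‖ + Λ * ‖ζ‖) (hs : γ * s' + Λ * θ ≤ s)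
    {f : H → ℝ} (hfm : Measurable f) (hf1 : ∀ x, |f x| ≤ 1)
    (hfX : ∀ x ∈ X, ∀ y ∈ X, |f x - f y| ≤ c)
    (hfs : ∀ x ∈ X, ∀ y ∈ X, ‖x‖ ≤ s → ‖y‖ ≤ s → |f x - f y| ≤ c * (1 - a))
    {u u' : H} (hu : u ∈ X) (hu' : u' ∈ X) (hus : ‖u‖ ≤ s') (hus' : ‖u'‖ ≤ s') :
    |markovOp ℓ F f u - markovOp ℓ F f u'| ≤ c * (1 - a * ℓ.real (Metric.ball 0 θ)) := by
  have hi := integrable_comp_section (ℓ := ℓ) hF hfm hf1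
  have hball : MeasurableSet (Metric.ball (0 : E) θ) := Metric.isOpen_ball.measurableSet
  have hind : Integrable ((Metric.ball (0 : E) θ).indicator (1 : E → ℝ)) ℓ :=
    (integrable_const 1).indicator hball
  have hbound : ∀ᵐ ζ ∂ℓ, ‖f (F (u, ζ)) - f (F (u', ζ))‖ ≤
      c * (1 - a * (Metric.ball (0 : E) θ).indicator 1 ζ) := by
    filter_upwards [hK] with ζ hζ
    by_cases hζθ : ζ ∈ Metric.ball (0 : E) θ
    · rw [indicator_of_mem hζθ, Pi.one_apply, mul_one]
      rw [mem_ball_zero_iff] at hζθ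
      have hle : ∀ w ∈ X, ‖w‖ ≤ s' → ‖F (w, ζ)‖ ≤ s := fun w hw hws =>
        (hdis w hw ζ hζ).trans ((add_le_add (mul_le_mul_of_nonneg_left hws hγ)
          (mul_le_mul_of_nonneg_left hζθ.le hΛ)).trans hs)
      exact hfs _ (hinv u hu ζ hζ) _ (hinv u' hu' ζ hζ) (hle u hu hus) (hle u' hu' hus')
    · rw [indicator_of_notMem hζθ, mul_zero, sub_zero, mul_one]
      exact hfX _ (hinv u hu ζ hζ) _ (hinv u' hu' ζ hζ)
  rw [markovOp, markovOp, ← integral_sub (hi u) (hi u')]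
  refine (norm_integral_le_of_norm_le (((integrable_const 1).sub (hind.const_mul a)).const_mul c)
    hbound).trans_eq ?_
  rw [integral_const_mul, integral_sub' (integrable_const 1) (hind.const_mul a),
    integral_const_mul, integral_indicator_one hball]
  simp

variable [BorelSpace H]

/-- Several steps of the Markov operator contract the Lipschitz seminorm for the truncated metric. -/
lemma exists_observable_contraction (hF : Measurable F) (hK : ∀ᵐ ζ ∂ℓ, ζ ∈ K)
    (hinv : ∀ u ∈ X, ∀ ζ ∈ K, F (u, ζ) ∈ X) {C δ₀ δ : ℝ} (hgrad : GradientBound ℓ F X C δ₀)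
    (hδ : 0 < δ) (hδ₀ : δ ≤ δ₀) (hCδ : C * δ ≤ 1 / 4) {γ Λ R : ℝ} (hγ : 0 < γ) (hγ1 : γ < 1)
    (hΛ : 0 ≤ Λ) (hdis : ∀ u ∈ X, ∀ ζ ∈ K, ‖F (u, ζ)‖ ≤ γ * ‖u‖ + Λ * ‖ζ‖)
    (hXR : ∀ u ∈ X, ‖u‖ ≤ R) (hpos : ∀ θ > 0, 0 < ℓ (Metric.ball 0 θ)) :
    ∃ (n : ℕ) (κ : ℝ), 0 < n ∧ 0 < κ ∧ κ < 1 ∧ ∀ (c : ℝ) (f : H → ℝ), 0 ≤ c →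
      Observable X δ c f → Observable X δ (κ * c) ((markovOp ℓ F)^[n] f) := by
  -- Two points of norm at most `s₀` are at distance at most `δ / 2`, which gives the initial gain
  -- `1 / 2`.
  set s₀ := δ / 4 with hs₀
  have hs₀pos : 0 < s₀ := by positivity
  -- Here `γ * q = (1 + γ) / 2 < 1`, so one step with noise below `θ` maps the ball of radius `s₀ *
  -- q ^ (m + 1)` into that of radius `s₀ * q ^ m`; the slack `(1 - γ) / 2 * s₀` absorbs `Λ * θ`.
  set q := (1 + γ) / (2 * γ) with hq
  have hγq : γ * q = (1 + γ) / 2 := by rw [hq]; field_simp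
  have hq1 : 1 < q := by
    rw [hq, one_lt_div (by positivity)]
    linarith
  set θ := (1 - γ) / 2 * s₀ / (Λ + 1) with hθ
  have h1γ : 0 < 1 - γ := by linarith
  have hθ0 : 0 < θ := by positivity
  have hΛθ : Λ * θ ≤ (1 - γ) / 2 * s₀ := by
    have : Λ * θ = (1 - γ) / 2 * s₀ * (Λ / (Λ + 1)) := by rw [hθ]; ring
    rw [this]
    exact mul_le_of_le_one_right (by positivity) ((div_le_one (by positivity)).2 (by linarith))
  set p := ℓ.real (Metric.ball (0 : E) θ) with hp
  have hp0 : 0 < p := ENNReal.toReal_pos (hpos θ hθ0).ne' (measure_ne_top _ _)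
  have hp1 : p ≤ 1 := measureReal_le_one
  -- Each further step enlarges the ball by `q` and multiplies the gain by the probability `p` of
  -- small noise.
  have key : ∀ (c : ℝ) (f : H → ℝ), 0 ≤ c → Observable X δ c f → ∀ m : ℕ, ∀ x ∈ X, ∀ y ∈ X,
      ‖x‖ ≤ s₀ * q ^ m → ‖y‖ ≤ s₀ * q ^ m →
        |(markovOp ℓ F)^[m] f x - (markovOp ℓ F)^[m] f y| ≤ c * (1 - 1 / 2 * p ^ m) := by
    intro c f hc hf m
    induction m with
    | zero =>
      intro x hx y hy hxs hys
      rw [pow_zero, mul_one] at hxs hys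
      refine (hf.2.2 x hx y hy).trans (mul_le_mul_of_nonneg_left ((min_le_right _ _).trans ?_) hc)
      rw [div_le_iff₀ hδ, pow_zero]
      refine (norm_sub_le _ _).trans ?_
      linarith
    | succ m ih =>
      intro x hx y hy hxs hys
      have hobs := hf.iterate_markovOp hF hK hinv hgrad hδ hδ₀ hCδ hc m
      have hqm : 1 ≤ q ^ m := one_le_pow₀ hq1.le
      rw [Function.iterate_succ_apply', pow_succ, ← mul_assoc]
      refine abs_markovOp_sub_le_of_ball hF hK hinv hγ.le hΛ hdis (s := s₀ * q ^ m)
        (s' := s₀ * q ^ (m + 1)) ?_ hobs.1 hobs.2.1 (fun x hx y hy => (hobs.2.2 x hx y hy).trans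
          (mul_le_of_le_one_right hc (min_le_left _ _))) ih hx hy hxs hys
      have : γ * (s₀ * q ^ (m + 1)) = s₀ * q ^ m * (γ * q) := by ring
      rw [this, hγq]
      nlinarith [mul_pos h1γ hs₀pos]
  obtain ⟨n, hn⟩ := pow_unbounded_of_one_lt (R / s₀) hq1
  have hR : R ≤ s₀ * q ^ (n + 1) := by
    rw [div_lt_iff₀ hs₀pos] at hn
    have : q ^ n ≤ q ^ (n + 1) := pow_le_pow_right₀ hq1.le (Nat.le_succ n)
    nlinarith
  set a := 1 / 2 * p ^ (n + 1) with ha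
  have ha0 : 0 < a := by positivity
  -- This makes the near-pair factor `1 / 2` at most `1 - a`, so one rate serves both cases.
  have ha1 : a ≤ 1 / 2 := by
    have : p ^ (n + 1) ≤ 1 := pow_le_one₀ hp0.le hp1
    linarith
  refine ⟨n + 1, 1 - a, Nat.succ_pos n, by linarith, by linarith, fun c f hc hf => ?_⟩
  have hobs := hf.iterate_markovOp hF hK hinv hgrad hδ hδ₀ hCδ hc
  refine ⟨(hobs _).1, (hobs _).2.1, fun u hu u' hu' => ?_⟩
  rcases le_or_gt ‖u - u'‖ δ with h | h
  · rw [min_eq_right ((div_le_one hδ).2 h), Function.iterate_succ_apply']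
    refine ((hobs n).abs_markovOp_sub_le_of_near hF hK hinv hgrad hδ hδ₀ hCδ hc hu hu' h).trans ?_
    refine mul_le_mul_of_nonneg_right ?_ (by positivity)
    nlinarith
  · rw [min_eq_left ((one_le_div hδ).2 h.le), mul_one, mul_comm]
    exact key c f hc hf (n + 1) u hu u' hu' ((hXR u hu).trans hR) ((hXR u' hu').trans hR)

/-- Exponential mixing on the invariant set `X`. -/
lemma exists_exponential_bound (hF : Measurable F) (hK : ∀ᵐ ζ ∂ℓ, ζ ∈ K)
    (hinv : ∀ u ∈ X, ∀ ζ ∈ K, F (u, ζ) ∈ X) {C δ₀ : ℝ} (hgrad : GradientBound ℓ F X C δ₀)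
    (hC : 0 ≤ C) (hδ₀ : 0 < δ₀) {γ Λ R : ℝ} (hγ : 0 < γ) (hγ1 : γ < 1)
    (hΛ : 0 ≤ Λ) (hdis : ∀ u ∈ X, ∀ ζ ∈ K, ‖F (u, ζ)‖ ≤ γ * ‖u‖ + Λ * ‖ζ‖)
    (hXR : ∀ u ∈ X, ‖u‖ ≤ R) (hpos : ∀ θ > 0, 0 < ℓ (Metric.ball 0 θ)) :
    ∃ κ D : ℝ, 0 < κ ∧ κ < 1 ∧ 0 < D ∧ ∀ f : H → ℝ, (∀ x, |f x| ≤ 1) → LipschitzWith 1 f →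
      ∀ u ∈ X, ∀ u' ∈ X, ∀ k : ℕ,
        |(markovOp ℓ F)^[k] f u - (markovOp ℓ F)^[k] f u'| ≤ D * ‖u - u'‖ * κ ^ k := by
  set δ := min 1 (min δ₀ (1 / (4 * (C + 1)))) with hδdef
  have hδ : 0 < δ := by positivity
  have hδ1 : δ ≤ 1 := min_le_left _ _
  have hδδ₀ : δ ≤ δ₀ := (min_le_right _ _).trans (min_le_left _ _)
  have hCδ : C * δ ≤ 1 / 4 := by
    have h1 : δ ≤ 1 / (4 * (C + 1)) := (min_le_right _ _).trans (min_le_right _ _)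
    rw [le_div_iff₀ (by positivity)] at h1
    nlinarith
  obtain ⟨n, κ, hn, hκ0, hκ1, hcontr⟩ := exists_observable_contraction hF hK hinv hgrad hδ hδδ₀ hCδ
    hγ hγ1 hΛ hdis hXR hpos
  set κ' := κ ^ (1 / (n : ℝ)) with hκ'
  have hκ'0 : 0 < κ' := Real.rpow_pos_of_pos hκ0 _
  have hn' : (0 : ℝ) < n := by exact_mod_cast hn
  have hκ'1 : κ' < 1 := Real.rpow_lt_one hκ0.le hκ1 (by positivity)
  have hκ'n : κ' ^ n = κ := by
    rw [hκ', ← Real.rpow_natCast, ← Real.rpow_mul hκ0.le, one_div_mul_cancel hn'.ne', Real.rpow_one]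
  refine ⟨κ', 2 / (δ * κ), hκ'0, hκ'1, by positivity, fun f hf1 hf u hu u' hu' k => ?_⟩
  -- The constant `2` comes from the oscillation of a function bounded by `1`; `δ ≤ 1` makes the
  -- slope bound `2 / δ` admissible.
  have hbase : Observable X δ 2 f := by
    refine ⟨hf.continuous.measurable, hf1, fun x _ y _ => ?_⟩
    have h1 : |f x - f y| ≤ ‖x - y‖ := by
      simpa [Real.dist_eq, dist_eq_norm] using hf.dist_le_mul x y
    have h2 : |f x - f y| ≤ 2 := (abs_sub _ _).trans (by linarith [hf1 x, hf1 y])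
    rw [mul_min_of_nonneg _ _ (by norm_num : (0 : ℝ) ≤ 2), mul_one]
    refine le_min h2 (h1.trans ?_)
    have h3 : ‖x - y‖ ≤ ‖x - y‖ / δ := (le_div_iff₀ hδ).2 (mul_le_of_le_one_right (norm_nonneg _) hδ1)
    have := norm_nonneg (x - y)
    linarith
  have hpow : ∀ m : ℕ, Observable X δ (κ ^ m * 2) ((markovOp ℓ F)^[n * m] f) := by
    intro m
    induction m with
    | zero => simpa using hbase
    | succ m ih =>
      rw [Nat.mul_succ, Nat.add_comm (n * m) n, Function.iterate_add_apply, pow_succ', mul_assoc]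
      exact hcontr _ _ (by positivity) ih
  have hk : Observable X δ (κ ^ (k / n) * 2) ((markovOp ℓ F)^[k] f) := by
    have h1 := (hpow (k / n)).iterate_markovOp hF hK hinv hgrad hδ hδδ₀ hCδ (by positivity) (k % n)
    rwa [← Function.iterate_add_apply, Nat.mod_add_div] at h1
  -- Since `k ≤ n * (k / n + 1)`, rounding down loses at most one factor `κ`.
  have hκk : κ ^ (k / n) ≤ κ' ^ k / κ := by
    rw [le_div_iff₀ hκ0, ← pow_succ, ← hκ'n, ← pow_mul]
    refine pow_le_pow_of_le_one hκ'0.le hκ'1.le ?_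
    have := Nat.div_add_mod k n
    have := Nat.mod_lt k hn
    rw [Nat.mul_succ]
    omega
  calc _ ≤ κ ^ (k / n) * 2 * min 1 (‖u - u'‖ / δ) := hk.2.2 u hu u' hu'
    _ ≤ κ' ^ k / κ * 2 * (‖u - u'‖ / δ) := by
        gcongr
        exact min_le_right _ _
    _ = _ := by
        field_simp

end Contraction

/-! ### Trajectories and iterates of the Markov operator -/

section Trajectories

variable {H E V Ω : Type*}
  [NormedAddCommGroup H] [InnerProductSpace ℝ H] [MeasurableSpace H] [BorelSpace H]
  [NormedAddCommGroup E] [SecondCountableTopology E]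
  [MeasurableSpace E] [BorelSpace E]
  [NormedAddCommGroup V] [NormedSpace ℝ V]

lemma measurable_traj_iSup {ι : V →L[ℝ] H} {S : H × E → V} (hS : Continuous S) (η : ℕ → Ω → E)
    (u : H) (k : ℕ) :
    Measurable[⨆ i ∈ Iio k, MeasurableSpace.comap (η i) inferInstance] (traj ι S η u k) := by
  induction k with
  | zero => exact measurable_const
  | succ k ih =>
    have hle : (⨆ i ∈ Iio k, MeasurableSpace.comap (η i) inferInstance) ≤
        ⨆ i ∈ Iio (k + 1), MeasurableSpace.comap (η i) inferInstance :=
      biSup_mono fun i hi => (mem_Iio.1 hi).trans (Nat.lt_succ_self k)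
    have hk : MeasurableSpace.comap (η k) inferInstance ≤
        ⨆ i ∈ Iio (k + 1), MeasurableSpace.comap (η i) inferInstance :=
      le_iSup₂ (f := fun i (_ : i ∈ Iio (k + 1)) => MeasurableSpace.comap (η i) inferInstance)
        k (mem_Iio.2 (Nat.lt_succ_self k))
    have h1 := ih.mono hle le_rfl
    have h2 := (comap_measurable (η k)).mono hk le_rfl
    have hF : Measurable fun p : H × E => ι (S p) := (ι.continuous.comp hS).measurable
    exact hF.comp (h1.prodMk h2)

variable [MeasurableSpace Ω] {P : Measure Ω}

lemma measurable_traj {ι : V →L[ℝ] H} {S : H × E → V} (hS : Continuous S) {η : ℕ → Ω → E}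
    (hη : ∀ k, Measurable (η k)) (u : H) (k : ℕ) : Measurable (traj ι S η u k) :=
  (measurable_traj_iSup hS η u k).mono (iSup₂_le fun i _ => (hη i).comap_le) le_rfl

lemma indepFun_traj {ι : V →L[ℝ] H} {S : H × E → V} (hS : Continuous S) {η : ℕ → Ω → E}
    (hη : ∀ k, Measurable (η k)) (hind : iIndepFun η P) (u : H) (k : ℕ) :
    IndepFun (traj ι S η u k) (η k) P := by
  have h := indep_iSup_of_disjoint (m := fun i => MeasurableSpace.comap (η i) inferInstance)
    (fun i => (hη i).comap_le) hind (S := Iio k) (T := {k}) (by simp)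
  rw [IndepFun_iff_Indep]
  refine indep_of_indep_of_le_left (indep_of_indep_of_le_right h ?_) ?_
  · simp
  · exact (measurable_traj_iSup hS η u k).comap_le

/-- The Markov property: `u_k` depends only on the noise before time `k`, hence is independent of `η
k`. Integrating out the last noise replaces `f` at time `k + 1` by its image under the operator at
time `k`. -/
lemma integral_traj [IsProbabilityMeasure P] {ι : V →L[ℝ] H} {S : H × E → V} (hS : Continuous S)
    {η : ℕ → Ω → E} (hη : ∀ k, Measurable (η k)) (hind : iIndepFun η P) {ℓ : Measure E}
    (hlaw : ∀ k, P.map (η k) = ℓ) (u : H) (k : ℕ) {f : H → ℝ} (hf : Measurable f)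
    (hf1 : ∀ x, |f x| ≤ 1) :
    ∫ ω, f (traj ι S η u k ω) ∂P = (markovOp ℓ fun p => ι (S p))^[k] f u := by
  have : IsProbabilityMeasure ℓ := by
    rw [← hlaw 0]
    exact Measure.isProbabilityMeasure_map (hη 0).aemeasurable
  have hF : Measurable fun p : H × E => ι (S p) := (ι.continuous.comp hS).measurable
  induction k generalizing f with
  | zero => simp [traj]
  | succ k ih =>
    rw [Function.iterate_succ_apply, ← ih (measurable_markovOp hF hf) (abs_markovOp_le hf1)]
    have hT := measurable_traj (ι := ι) hS hη u k
    have : IsProbabilityMeasure (P.map (traj ι S η u k)) :=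
      Measure.isProbabilityMeasure_map hT.aemeasurable
    have hprod := (indepFun_iff_map_prod_eq_prod_map_map hT.aemeasurable (hη k).aemeasurable).1
      (indepFun_traj (ι := ι) hS hη hind u k)
    rw [hlaw k] at hprod
    have hint : Integrable (fun p : H × E => f (ι (S p))) ((P.map (traj ι S η u k)).prod ℓ) :=
      Integrable.of_bound (hf.comp hF).aestronglyMeasurable 1
        (Filter.Eventually.of_forall fun p => hf1 _)
    calc ∫ ω, f (traj ι S η u (k + 1) ω) ∂P
        = ∫ p, f (ι (S p)) ∂(P.map fun ω => (traj ι S η u k ω, η k ω)) :=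
          (integral_map (hT.prodMk (hη k)).aemeasurable (hf.comp hF).aestronglyMeasurable).symm
      _ = ∫ x, markovOp ℓ (fun p => ι (S p)) f x ∂(P.map (traj ι S η u k)) := by
          rw [hprod, integral_prod _ hint]
          rfl
      _ = _ := integral_map hT.aemeasurable
          (measurable_markovOp hF hf).aestronglyMeasurable

end Trajectories

/-! ### Positive probability of small noise -/

section Noise

variable {Ω : Type*} [MeasurableSpace Ω] {P : Measure Ω}

lemma withDensity_Icc_pos {ρ : ℝ → ℝ} (hρ : Continuous ρ) (h0 : ∀ r, 0 ≤ ρ r) (hne : ρ 0 ≠ 0)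
    {τ : ℝ} (hτ : 0 < τ) :
    0 < volume.withDensity (fun r => ENNReal.ofReal (ρ r)) (Icc (-τ) τ) := by
  rw [withDensity_apply _ measurableSet_Icc,
    setLIntegral_pos_iff hρ.measurable.ennreal_ofReal]
  have hopen : IsOpen ({r | 0 < ρ r} ∩ Ioo (-τ) τ) :=
    (isOpen_lt continuous_const hρ).inter isOpen_Ioo
  have hmem : (0 : ℝ) ∈ {r | 0 < ρ r} ∩ Ioo (-τ) τ :=
    ⟨lt_of_le_of_ne (h0 0) hne.symm, by linarith, hτ⟩
  refine (hopen.measure_pos volume ⟨0, hmem⟩).trans_le (measure_mono fun r hr => ?_)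
  exact ⟨(ENNReal.ofReal_pos.2 hr.1).ne', Ioo_subset_Icc_self hr.2⟩

/-- The noise charges every neighbourhood of the origin. -/
lemma measure_norm_lt_pos {E : Type*} [NormedAddCommGroup E] [InnerProductSpace ℝ E]
    {ξ : ℕ → Ω → ℝ} (hξ : ∀ i, Measurable (ξ i))
    (hind : iIndepFun ξ P) (hbdd : ∀ i, ∀ᵐ ω ∂P, |ξ i ω| ≤ 1) {ρ : ℕ → ℝ → ℝ}
    (hρ : ∀ j, (∀ r, 0 ≤ ρ j r) ∧ (∃ L, LipschitzWith L (ρ j)) ∧ ρ j 0 ≠ 0)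
    (hlaw : ∀ j, P.map (ξ j) = volume.withDensity (fun r => ENNReal.ofReal (ρ j r)))
    (e : HilbertBasis ℕ ℝ E) {b : ℕ → ℝ} (hb : Summable fun j => b j ^ 2) {η : Ω → E}
    (hη : ∀ᵐ ω ∂P, HasSum (fun j => ξ j ω • (b j • e j)) (η ω)) {θ : ℝ} (hθ : 0 < θ) :
    0 < P {ω | ‖η ω‖ < θ} := by
  obtain ⟨M, -, τ, hτ0, hτ⟩ := exists_norm_lt_of_coeff e hb hθ 0
  have hprod := hind.measure_inter_preimage_eq_mul (Finset.range M) (sets := fun _ => Icc (-τ) τ)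
    (fun _ _ => measurableSet_Icc)
  have hpos : 0 < P (⋂ j ∈ Finset.range M, ξ j ⁻¹' Icc (-τ) τ) := by
    rw [hprod, pos_iff_ne_zero, Finset.prod_ne_zero_iff]
    intro j _
    obtain ⟨h0, ⟨L, hL⟩, hne⟩ := hρ j
    rw [← Measure.map_apply (hξ j) measurableSet_Icc, hlaw j]
    exact (withDensity_Icc_pos hL.continuous h0 hne hτ0).ne'
  refine hpos.trans_le (measure_mono_ae ?_)
  filter_upwards [ae_all_iff.2 hbdd, hη] with ω h1 h2 h3
  refine hτ (fun j => ξ j ω) (fun j => (h1 j).trans one_le_two) (fun j hj => ?_) _ h2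
  exact abs_le.2 (mem_iInter₂.1 h3 j (Finset.mem_range.2 hj))

end Noise

/-! ### Consequences of the assumptions on `S` -/

section System

variable {H E V : Type*}
  [NormedAddCommGroup H] [InnerProductSpace ℝ H]
  [NormedAddCommGroup E] [InnerProductSpace ℝ E]
  [NormedAddCommGroup V] [NormedSpace ℝ V]

lemma Regularity.exists_lipschitzOn {S : H × E → V} (hS : Regularity S) (ι : V →L[ℝ] H) (r : ℝ) :
    ∃ Λ : ℝ, 0 ≤ Λ ∧ ∀ p ∈ Metric.closedBall (0 : H × E) r, ∀ q ∈ Metric.closedBall (0 : H × E) r,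
      ‖ι (S p) - ι (S q)‖ ≤ Λ * ‖p - q‖ := by
  obtain ⟨C, hC⟩ := hS.2 _ (Metric.isBounded_closedBall (x := (0 : H × E)) (r := r))
  have hd := hS.1.differentiable two_ne_zero
  refine ⟨‖ι‖ * |C|, by positivity, fun p hp q hq => ?_⟩
  have h := (convex_closedBall (0 : H × E) r).norm_image_sub_le_of_norm_fderiv_le (𝕜 := ℝ)
    (f := S) (C := C) (fun x _ => hd x)
    (fun x hx => by rw [← norm_iteratedFDeriv_one]; exact hC x hx 1 one_le_two) hq hp
  rw [← map_sub, mul_assoc]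
  exact (ι.le_opNorm _).trans (mul_le_mul_of_nonneg_left (h.trans
    (mul_le_mul_of_nonneg_right (le_abs_self C) (norm_nonneg _))) (norm_nonneg _))

lemma Regularity.isCompact_closure_image {S : H × E → V} (hS : Regularity S) {ι : V →L[ℝ] H}
    (hι : IsCompactOperator ι) {B : Set (H × E)} (hB : Bornology.IsBounded B) :
    IsCompact (closure ((fun p => ι (S p)) '' B)) := by
  obtain ⟨C, hC⟩ := hS.2 B hB
  have hbdd : Bornology.IsBounded (S '' B) := by
    refine isBounded_iff_forall_norm_le.2 ⟨C, ?_⟩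
    rintro _ ⟨p, hp, rfl⟩
    have := hC p hp 0 (Nat.zero_le 2)
    rwa [norm_iteratedFDeriv_zero] at this
  have h := hι.isCompact_closure_image_of_bounded (f := (ι : V →ₗ[ℝ] H)) hbdd
  rwa [image_image] at h

lemma fderiv_comp_apply {S : H × E → V} (hS : Differentiable ℝ S) (ι : V →L[ℝ] H) (p : H × E) :
    fderiv ℝ (fun p => ι (S p)) p = ι.comp (fderiv ℝ S p) :=
  (ι.hasFDerivAt.comp p (hS p).hasFDerivAt).fderiv

lemma isCompactOperator_fderiv_left {S : H × E → V} (hS : Differentiable ℝ S) {ι : V →L[ℝ] H}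
    (hι : IsCompactOperator ι) (p : H × E) :
    IsCompactOperator fun v : H => fderiv ℝ (fun p => ι (S p)) p (v, 0) := by
  rw [fderiv_comp_apply hS]
  exact hι.comp_clm ((fderiv ℝ S p).comp (ContinuousLinearMap.inl ℝ H E))

lemma Nondegenerate.denseRange_fderiv_right {S : H × E → V} (hS : Differentiable ℝ S)
    {ι : V →L[ℝ] H} {K : Set E} (h : Nondegenerate ι S K) {p : H × E} (hp : p.2 ∈ K) :
    DenseRange fun h : E => fderiv ℝ (fun p => ι (S p)) p (0, h) := by
  have h1 := h p.1 p.2 hp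
  have h2 : fderiv ℝ (fun ζ : E => S (p.1, ζ)) p.2 =
      (fderiv ℝ S p).comp (ContinuousLinearMap.inr ℝ H E) :=
    ((hS p).hasFDerivAt.comp p.2 (hasFDerivAt_prodMk_right p.1 p.2)).fderiv
  rw [h2] at h1
  rw [fderiv_comp_apply hS]
  exact h1

end System

end RDS

/-! ### The main theorem -/

theorem mainTheorem2
    {H E V Ω : Type*}
    [NormedAddCommGroup H] [InnerProductSpace ℝ H] [CompleteSpace H]
    [TopologicalSpace.SeparableSpace H] [MeasurableSpace H] [BorelSpace H]
    [NormedAddCommGroup E] [InnerProductSpace ℝ E] [CompleteSpace E]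
    [TopologicalSpace.SeparableSpace E] [MeasurableSpace E] [BorelSpace E]
    [NormedAddCommGroup V] [NormedSpace ℝ V] [CompleteSpace V]
    [MeasurableSpace Ω] (P : Measure Ω) [IsProbabilityMeasure P]
    (ι : V →L[ℝ] H) (hι_inj : Function.Injective ι) (hι_dense : DenseRange ι)
    (hι_compact : IsCompactOperator ι)
    (S : H × E → V)
    (η : ℕ → Ω → E) (hη_meas : ∀ k, Measurable (η k)) (hη_indep : iIndepFun η P)
    (ℓ : Measure E) (hη_law : ∀ k, P.map (η k) = ℓ)
    (hK : IsCompact ℓ.support)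
    (hA1 : RDS.Regularity S)
    (hH1 : RDS.DecomposableNoise P η)
    (hH2 : RDS.Dissipative ι S ℓ.support)
    (hH3 : RDS.Nondegenerate ι S ℓ.support) :
    ∀ R : ℝ, 0 < R → ∃ κ C : ℝ, 0 < κ ∧ κ < 1 ∧ 0 < C ∧
      ∀ u ∈ Metric.closedBall (0 : H) R, ∀ u' ∈ Metric.closedBall (0 : H) R, ∀ k : ℕ,
        RDS.lipDual (RDS.transProb P ι S η k u) (RDS.transProb P ι S η k u') ≤
          C * ‖u - u'‖ * κ ^ k := by
  intro R hR
  have : SecondCountableTopology E := UniformSpace.secondCountable_of_separable E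
  have hℓ : IsProbabilityMeasure ℓ := by
    rw [← hη_law 0]
    exact Measure.isProbabilityMeasure_map (hη_meas 0).aemeasurable
  obtain ⟨e, b, ξ, ρ, hb0, hb, hξm, hξi, hξb, hρ, hξlaw, hηsum⟩ := hH1
  obtain ⟨γ, β, hγ0, hγ1, hβ, hdis⟩ := hH2
  set K := ℓ.support with hKdef
  set F : H × E → H := fun p => ι (S p) with hFdef
  have hSc : Continuous S := hA1.1.continuous
  have hSd : Differentiable ℝ S := hA1.1.differentiable two_ne_zero
  have hF1 : ContDiff ℝ 1 F := ι.contDiff.comp (hA1.1.of_le one_le_two)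
  have hFc : Continuous F := hF1.continuous
  have hFm : Measurable F := hFc.measurable
  have hKae : ∀ᵐ ζ ∂ℓ, ζ ∈ K := Measure.support_mem_ae
  have hηK : ∀ᵐ ω ∂P, η 0 ω ∈ K :=
    ae_of_ae_map (hη_meas 0).aemeasurable (by rw [hη_law 0]; exact hKae)
  have hηsum' : ∀ᵐ ω ∂P, HasSum (fun j => ξ (j, 0) ω • (b j • e j)) (η 0 ω) := by
    filter_upwards [hηsum 0] with ω hω
    simpa only [smul_smul, mul_comm] using hω
  have hξi' : iIndepFun (fun j => ξ (j, 0)) P :=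
    hξi.precomp (g := fun j : ℕ => (j, 0)) fun i j h => (Prod.ext_iff.1 h).1
  -- the absorbing ball and the compact invariant set
  set R' := max R (β / (1 - γ)) with hR'
  have h1γ : 0 < 1 - γ := by linarith
  have hR'0 : 0 < R' := lt_max_of_lt_left hR
  have hball : ∀ u : H, ‖u‖ ≤ R' → ∀ ζ ∈ K, ‖F (u, ζ)‖ ≤ R' := by
    intro u hu ζ hζ
    have h1 : β ≤ R' * (1 - γ) := (div_le_iff₀ h1γ).1 (le_max_right _ _)
    have h2 := (hdis u).1 ζ hζ
    have h3 := mul_le_mul_of_nonneg_left hu hγ0.le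
    simp only [hFdef]
    linarith
  -- One step from the ball lands in `X`, which is compact since `ι` is compact and `S` is bounded
  -- on bounded sets, and invariant since it lies in that same ball.
  set X : Set H := closure (F '' (Metric.closedBall (0 : H) R' ×ˢ K)) with hX
  have hXc : IsCompact X :=
    hA1.isCompact_closure_image hι_compact (Metric.isBounded_closedBall.prod hK.isBounded)
  have hXR : ∀ u ∈ X, ‖u‖ ≤ R' := by
    have : X ⊆ Metric.closedBall (0 : H) R' := by
      refine closure_minimal ?_ Metric.isClosed_closedBall
      rintro _ ⟨⟨u, ζ⟩, ⟨hu, hζ⟩, rfl⟩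
      rw [mem_closedBall_zero_iff] at hu ⊢
      exact hball u hu ζ hζ
    exact fun u hu => mem_closedBall_zero_iff.1 (this hu)
  have hmemX : ∀ u : H, ‖u‖ ≤ R' → ∀ ζ ∈ K, F (u, ζ) ∈ X := fun u hu ζ hζ =>
    subset_closure ⟨(u, ζ), ⟨mem_closedBall_zero_iff.2 hu, hζ⟩, rfl⟩
  have hinv : ∀ u ∈ X, ∀ ζ ∈ K, F (u, ζ) ∈ X := fun u hu => hmemX u (hXR u hu)
  -- Lipschitz bounds on a large ball
  obtain ⟨RK, hRK⟩ := hK.isBounded.exists_norm_le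
  obtain ⟨Λ, hΛ0, hΛ⟩ := hA1.exists_lipschitzOn ι (max R' RK)
  have hin : ∀ u : H, ‖u‖ ≤ R' → ∀ ζ : E, ‖ζ‖ ≤ max R' RK →
      (u, ζ) ∈ Metric.closedBall (0 : H × E) (max R' RK) := by
    intro u hu ζ hζ
    rw [mem_closedBall_zero_iff]
    exact max_le (hu.trans (le_max_left _ _)) hζ
  have hKn : ∀ ζ ∈ K, ‖ζ‖ ≤ max R' RK := fun ζ hζ => (hRK ζ hζ).trans (le_max_right _ _)
  have hlip : ∀ u u' : H, ‖u‖ ≤ R' → ‖u'‖ ≤ R' → ∀ ζ ∈ K,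
      ‖F (u, ζ) - F (u', ζ)‖ ≤ Λ * ‖u - u'‖ := by
    intro u u' hu hu' ζ hζ
    have h := hΛ (u, ζ) (hin u hu ζ (hKn ζ hζ)) (u', ζ) (hin u' hu' ζ (hKn ζ hζ))
    rwa [Prod.mk_sub_mk, sub_self, Prod.norm_mk, norm_zero, max_eq_left (norm_nonneg _)] at h
  -- The zero-noise contraction is combined with Lipschitz dependence on the noise, so that small
  -- noise gives an additive term proportional to `‖ζ‖` instead of `β`.
  have hdis' : ∀ u ∈ X, ∀ ζ ∈ K, ‖F (u, ζ)‖ ≤ γ * ‖u‖ + Λ * ‖ζ‖ := by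
    intro u hu ζ hζ
    have h := hΛ (u, ζ) (hin u (hXR u hu) ζ (hKn ζ hζ)) (u, 0)
      (hin u (hXR u hu) 0 (by rw [norm_zero]; exact hR'0.le.trans (le_max_left _ _)))
    rw [Prod.mk_sub_mk, sub_self, sub_zero, Prod.norm_mk, norm_zero,
      max_eq_right (norm_nonneg _)] at h
    have h2 := (hdis u).2
    have h3 := norm_add_le (ι (S (u, 0))) (ι (S (u, ζ)) - ι (S (u, 0)))
    rw [add_sub_cancel] at h3
    simp only [hFdef]
    linarith
  have hpos : ∀ θ > 0, 0 < ℓ (Metric.ball (0 : E) θ) := by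
    intro θ hθ
    have h := RDS.measure_norm_lt_pos (fun j => hξm (j, 0)) hξi' (fun j => hξb (j, 0)) hρ
      (fun j => hξlaw j 0) e hb hηsum' hθ
    rw [← hη_law 0, Measure.map_apply (hη_meas 0) Metric.isOpen_ball.measurableSet]
    convert h using 2
    ext ω
    simp
  obtain ⟨C₀, δ₀, hC₀, hδ₀, hgrad₀⟩ := RDS.exists_gradient_bound (fun j => hξm (j, 0)) hξi'
    (fun j => hξb (j, 0)) (fun j => ⟨(hρ j).1, (hρ j).2.1⟩) (fun j => hξlaw j 0) e hb0 hb
    (hη_meas 0) hηsum' hK hηK hF1 hXc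
    (fun p _ => RDS.isCompactOperator_fderiv_left hSd hι_compact p)
    (fun p hp => hH3.denseRange_fderiv_right hSd hp.2) (ε := 1 / 4) (by norm_num)
  have hgrad : RDS.GradientBound ℓ F X C₀ δ₀ := by
    intro u hu u' _ huu g L B hg hB
    have hop : ∀ w, RDS.markovOp ℓ F g w = ∫ ω, g (F (w, η 0 ω)) ∂P := by
      intro w
      rw [RDS.markovOp, ← hη_law 0]
      exact integral_map (hη_meas 0).aemeasurable
        (hg.continuous.comp (hFc.comp (by fun_prop))).aestronglyMeasurable
    rw [hop, hop]
    exact hgrad₀ u hu u' huu g L B hg hB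
  obtain ⟨κ, D, hκ0, hκ1, hD, hmain⟩ := RDS.exists_exponential_bound hFm hKae hinv hgrad hC₀ hδ₀
    hγ0 hγ1 hΛ0 hdis' hXR hpos
  -- The `1` covers `k = 0`, where the initial points need not lie in `X`. For `k + 1` the first
  -- step moves both points into `X`, at the price of the Lipschitz factor `Λ` and one power of `κ`.
  refine ⟨κ, max 1 (D * Λ / κ), hκ0, hκ1, by positivity, fun u hu u' hu' k => ?_⟩
  have huR : ‖u‖ ≤ R' := (mem_closedBall_zero_iff.1 hu).trans (le_max_left _ _)
  have huR' : ‖u'‖ ≤ R' := (mem_closedBall_zero_iff.1 hu').trans (le_max_left _ _)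
  refine csSup_le (RDS.lipDualSet_nonempty _ _) ?_
  rintro _ ⟨f, hf1, hf, rfl⟩
  have hfm : Measurable f := hf.continuous.measurable
  have hint : ∀ w : H, ∫ x, f x ∂(RDS.transProb P ι S η k w) = (RDS.markovOp ℓ F)^[k] f w := by
    intro w
    rw [RDS.transProb, integral_map (RDS.measurable_traj hSc hη_meas w k).aemeasurable
      hfm.aestronglyMeasurable]
    exact RDS.integral_traj hSc hη_meas hη_indep hη_law w k hfm hf1
  rw [hint, hint]
  cases k with
  | zero =>
    have h : |f u - f u'| ≤ ‖u - u'‖ := by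
      simpa [Real.dist_eq, dist_eq_norm] using hf.dist_le_mul u u'
    rw [pow_zero, mul_one]
    exact h.trans (le_mul_of_one_le_left (norm_nonneg _) (le_max_left _ _))
  | succ k =>
    have hgk : Measurable ((RDS.markovOp ℓ F)^[k] f) ∧ ∀ x, |(RDS.markovOp ℓ F)^[k] f x| ≤ 1 := by
      clear hint
      induction k with
      | zero => exact ⟨hfm, hf1⟩
      | succ k ih =>
        rw [Function.iterate_succ_apply']
        exact ⟨RDS.measurable_markovOp hFm ih.1, RDS.abs_markovOp_le ih.2⟩
    have hi := RDS.integrable_comp_section (ℓ := ℓ) hFm hgk.1 hgk.2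
    rw [Function.iterate_succ_apply', RDS.markovOp, RDS.markovOp, ← integral_sub (hi u) (hi u')]
    have hle : ∀ᵐ ζ ∂ℓ, ‖(RDS.markovOp ℓ F)^[k] f (F (u, ζ)) -
        (RDS.markovOp ℓ F)^[k] f (F (u', ζ))‖ ≤ D * (Λ * ‖u - u'‖) * κ ^ k := by
      filter_upwards [hKae] with ζ hζ
      refine (hmain f hf1 hf _ (hmemX u huR ζ hζ) _ (hmemX u' huR' ζ hζ) k).trans ?_
      have := hlip u u' huR huR' ζ hζ
      gcongr
    calc _ ≤ D * (Λ * ‖u - u'‖) * κ ^ k := by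
          simpa using norm_integral_le_of_norm_le_const hle
      _ = D * Λ / κ * ‖u - u'‖ * κ ^ (k + 1) := by
          rw [pow_succ]
          field_simp
      _ ≤ max 1 (D * Λ / κ) * ‖u - u'‖ * κ ^ (k + 1) := by
          gcongr
          exact le_max_right _ _
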